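/- Let $X$ be a locally compact Polish space, and let $\mathbb{K}(X)$ be the cone of nonnegative discrete Radon measures $\eta=\sum_i s_i\delta_{x_i}$ on $X$ (at most countably many distinct atoms $x_i\in X$, weights $s_i>0$), with the vague topology and its Borel $\sigma$-algebra. For $\eta\in\mathbb{K}(X)$ write $s_x=\eta(\{x\})$ and $\tau(\eta)=\{x: s_x>0\}$. Let $\mathbb{R}_+^*=(0,\infty)$ and $\hat X=\mathbb{R}_+^*\times X$. Let $\Pi(\hat X)$ be the set of locally finite configurations $\gamma\subset\hat X$ such that distinct points of $\gamma$ have distinct $X$-components and $\sum_{(s,x)\in\gamma,\,x\in\Lambda}s<\infty$ for every relatively compact Borel set $\Lambda\subset X$, and let $\mathcal{R}:\Pi(\hat X)\to\mathbb{K}(X)$, $\sum_{(s,x)\in\gamma}\delta_{(s,x)}\mapsto\sum_{(s,x)\in\gamma}s\delta_x$, which is a bijection. Let $\nu$ and $\sigma$ be non-atomic positive Radon measures on $\mathbb{R}_+^*$ and $X$, respectively, with $\int_{\mathbb{R}_+^*}s\,d\nu(s)<\infty$. Let $\pi=\pi_{\mathbb{K},\nu\otimes\sigma}$ be the push-forward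 to $\mathbb{K}(X)$ under $\mathcal{R}$ of (the restriction to $\Pi(\hat X)$ of) the Poisson measure with intensity $\nu\otimes\sigma$ on the locally finite configurations over $\hat X$. Let $\mathcal{F}$ be the space of cylinder functions $F(\eta)=g(\langle\mathcal{R}^{-1}\eta,\varphi_1\rangle,\dots,\langle\mathcal{R}^{-1}\eta,\varphi_N\rangle)$ with $N\ge1$, $g\in C_{\mathrm b}(\mathbb{R}^N)$, $\varphi_i\in C_{\mathrm c}(\hat X)$. Define the discrete death and birth gradients $$(D_x^-F)(\eta)=F(\eta-s_x\delta_x)-F(\eta)\quad(x\in\tau(\eta)),\qquad (D^+_{(s,x)}F)(\eta)=F(\eta+s\delta_x)-F(\eta)\quad((s,x)\in\hat X,\ x\notin\tau(\eta)),$$ and, for $F,G\in\mathcal{F}$, $$\mathcal{E}(F,G)=\int_{\mathbb{K}(X)}\int_X(D_x^-F)(\eta)(D_x^-G)(\eta)\,d\eta(x)\,d\pi(\eta).$$ Proposition. $\pi$ is a probability measure, $\mathcal{F}\subset L^2(\mathbb{K}(X),\pi)$, and $(\mathcal{E},\mathcal{F})$ is a well-defined symmetric bilinear form on $L^2(\mathbb{K}(X),\pi)$.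 That is: 1. For all $F\in\mathcal{F}$ and $\eta\in\mathbb{K}(X)$, $(D^-_\cdot F)(\eta)\in L^2(X,\eta)$ and $(D^+_\cdot F)(\eta)\in L^2(\hat X,s\,\nu(ds)\otimes\sigma(dx))$. 2. For all $F,G\in\mathcal{F}$, the functions $\eta\mapsto\langle D^-F(\eta),D^-G(\eta)\rangle_{L^2(X,\eta)}$ and $\eta\mapsto\langle D^+F(\eta),D^+G(\eta)\rangle_{L^2(\hat X,s\nu\otimes\sigma)}$ are $\pi$-integrable, and they have the same integral, i.e. $$\mathcal{E}(F,G)=\int_{\mathbb{K}(X)}\int_{\hat X}s\,(D^+_{(s,x)}F)(\eta)\,(D^+_{(s,x)}G)(\eta)\,d(\nu\otimes\sigma)(s,x)\,d\pi(\eta).$$ 3. $\mathcal{E}(F,G)$ depends only on the $\pi$-a.e. equivalence classes of $F$ and $G$: the classes of the functions in $\mathcal{F}$ form a linear subspace of $L^2(\mathbb{K}(X),\pi)$, and there is exactly one symmetric bilinear form $B$ on this subspace with $B([F],[G])=\mathcal{E}(F,G)$ for all $F,G\in\mathcal{F}$. -/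

import Mathlib

open MeasureTheory Set
open scoped ENNReal BoundedContinuousFunction CompactlySupported

set_option linter.unusedSectionVars false

noncomputable section

/-! ### Locally finite configurations -/

/-- A locally finite configuration over `E`: a set of points which meets every compact set in
finitely many points. -/
@[ext]
structure Config (E : Type*) [TopologicalSpace E] where
  points : Set E
  finite_inter : ∀ K : Set E, IsCompact K → (points ∩ K).Finite

namespace Config

variable {E : Type*} [TopologicalSpace E]

/-- The measure `∑_{y ∈ γ} δ_y` with which the configuration `γ` is identified. -/
def toMeasure [MeasurableSpace E] (γ : Config E) : Measure E :=
  Measure.sum fun y : γ.points => Measure.dirac (y : E)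

/-- The vague topology, induced by the maps `γ ↦ ⟨γ, f⟩ = ∫ f dγ`, `f ∈ C_c(E)`. -/
instance [MeasurableSpace E] : TopologicalSpace (Config E) :=
  ⨅ f : C_c(E, ℝ), TopologicalSpace.induced (fun γ => ∫ y, f y ∂γ.toMeasure) inferInstance

instance [MeasurableSpace E] : MeasurableSpace (Config E) := borel _

theorem countable [SigmaCompactSpace E] (γ : Config E) : γ.points.Countable := by
  have h : γ.points = ⋃ n, γ.points ∩ compactCovering E n := by
    rw [← inter_iUnion, iUnion_compactCovering, inter_univ]
  rw [h]
  exact countable_iUnion fun n => (γ.finite_inter _ (isCompact_compactCovering E n)).countable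

end Config

/-! ### The Poisson measure on the configuration space -/

section Poisson

variable {E : Type*} [MeasurableSpace E]

/-- Finite tuples of points of `E`, of arbitrary length. -/
abbrev Tuples (E : Type*) : Type _ := Σ k : ℕ, (Fin k → E)

/-- The law of the list of points of a Poisson process with finite intensity measure `ρ`:
`e^{-ρ(E)} ∑_k ρ^{⊗ k} / k!`. Equivalently, the number `k` of points is Poisson distributed with
parameter `ρ(E)` and, given `k`, the points are independent with distribution `ρ / ρ(E)`. -/
def tuplesLaw (ρ : Measure E) : Measure (Tuples E) :=
  Measure.sum fun k : ℕ =>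
    ENNReal.ofReal (Real.exp (-(ρ univ).toReal) / (k.factorial : ℝ)) •
      (Measure.pi fun _ : Fin k => ρ).map fun y => (⟨k, y⟩ : Tuples E)

instance (ρ : Measure E) [IsFiniteMeasure ρ] : IsProbabilityMeasure (tuplesLaw ρ) := by
  refine ⟨?_⟩
  have hm : ∀ k : ℕ, Measurable (fun y : Fin k → E => (⟨k, y⟩ : Tuples E)) := fun k =>
    measurable_iff_comap_le.2 (MeasurableSpace.comap_le_iff_le_map.2
      (iInf_le (fun k : ℕ => MeasurableSpace.map
        (fun y : Fin k → E => (⟨k, y⟩ : Tuples E)) MeasurableSpace.pi) k))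
  rw [tuplesLaw, Measure.sum_apply _ MeasurableSet.univ]
  have h1 : ∀ k : ℕ, (ENNReal.ofReal (Real.exp (-(ρ univ).toReal) / (k.factorial : ℝ)) •
      (Measure.pi fun _ : Fin k => ρ).map fun y => (⟨k, y⟩ : Tuples E)) (univ : Set (Tuples E)) =
      ENNReal.ofReal (Real.exp (-(ρ univ).toReal) * ((ρ univ).toReal ^ k / (k.factorial : ℝ))) := by
    intro k
    rw [Measure.smul_apply, Measure.map_apply (hm k) MeasurableSet.univ, preimage_univ,
      Measure.pi_univ, Finset.prod_const, Finset.card_univ, Fintype.card_fin, smul_eq_mul]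
    conv_lhs => rw [← ENNReal.ofReal_toReal (measure_ne_top ρ univ)]
    rw [← ENNReal.ofReal_pow ENNReal.toReal_nonneg, ← ENNReal.ofReal_mul (by positivity)]
    rw [ENNReal.toReal_ofReal ENNReal.toReal_nonneg]
    congr 1
    ring
  simp_rw [h1]
  have hs := NormedSpace.expSeries_div_hasSum_exp ((ρ univ).toReal)
  have hs' := hs.mul_left (Real.exp (-(ρ univ).toReal))
  rw [← ENNReal.ofReal_tsum_of_nonneg (fun k => by positivity) hs'.summable, hs'.tsum_eq,
    ← Real.exp_eq_exp_ℝ, ← Real.exp_add, neg_add_cancel, Real.exp_zero, ENNReal.ofReal_one]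

variable [TopologicalSpace E] [SigmaCompactSpace E] [WeaklyLocallyCompactSpace E]

/-- A partition of `E` into countably many relatively compact sets (the successive differences of
an exhaustion by compact sets). -/
def cell (E : Type*) [TopologicalSpace E] [SigmaCompactSpace E] [WeaklyLocallyCompactSpace E]
    (n : ℕ) : Set E :=
  disjointed (fun m => CompactExhaustion.choice E m) n

theorem cell_subset (n : ℕ) : cell E n ⊆ CompactExhaustion.choice E n :=
  disjointed_subset _ n

theorem disjoint_cell {m n : ℕ} (h : m < n) :
    Disjoint (CompactExhaustion.choice E m : Set E) (cell E n) := by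
  rw [cell, disjointed_apply]
  refine disjoint_sdiff_self_right.mono_left ?_
  exact Finset.le_sup (f := fun m => (CompactExhaustion.choice E m : Set E))
    (Finset.mem_Iio.2 h)

instance (μ : Measure E) [IsFiniteMeasureOnCompacts μ] (n : ℕ) :
    IsFiniteMeasure (μ.restrict (cell E n)) :=
  ⟨by
    rw [Measure.restrict_apply_univ]
    exact (measure_mono (cell_subset n)).trans_lt
      ((CompactExhaustion.choice E).isCompact n).measure_lt_top⟩

/-- The configuration formed by the points of a sequence of tuples, where the points of the `n`-th
tuple are used if they lie in the `n`-th cell. -/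
def configOfTuples (ω : ℕ → Tuples E) : Config E where
  points := {y | ∃ n, y ∈ cell E n ∧ ∃ i, (ω n).2 i = y}
  finite_inter K hK := by
    obtain ⟨N, hN⟩ := (CompactExhaustion.choice E).exists_superset_of_isCompact hK
    refine ((finite_Iic N).biUnion fun n _ => finite_range (ω n).2).subset ?_
    rintro y ⟨⟨n, hn, i, hi⟩, hy⟩
    have hnN : n ≤ N := by
      by_contra h
      exact (Set.disjoint_left.1 (disjoint_cell (not_le.1 h)) (hN hy)) hn
    exact mem_biUnion (show n ∈ Iic N from hnN) ⟨i, hi⟩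

/-- The Poisson measure on the configuration space over `E` whose intensity is the (non-atomic)
Radon measure `μ`: the law of the superposition of independent Poisson processes with the finite
intensities `μ|_{cell n}`, where the cells form a partition of `E`. -/
def poissonConfig (μ : Measure E) [IsFiniteMeasureOnCompacts μ] : Measure (Config E) :=
  (Measure.infinitePi fun n : ℕ => tuplesLaw (μ.restrict (cell E n))).map configOfTuples

end Poisson

/-! ### The cone of discrete Radon measures -/

/-- The cone `𝕂(X)` of nonnegative discrete Radon measures `η = ∑_i s_i δ_{x_i}` on `X`, with at
most countably many distinct atoms `x_i` and weights `s_i > 0`. -/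
@[ext]
structure Cone (X : Type*) [TopologicalSpace X] [MeasurableSpace X] where
  toMeasure : Measure X
  lt_top_of_isCompact : ∀ K : Set X, IsCompact K → toMeasure K < ∞
  exists_atoms : ∃ (A : Set X) (s : X → ℝ), A.Countable ∧ (∀ x ∈ A, 0 < s x) ∧
    toMeasure = Measure.sum fun x : A => ENNReal.ofReal (s x) • Measure.dirac (x : X)

/-- The half-line `ℝ₊* = (0, ∞)`. Its usual topology is that of the metric `|ln s₁ - ln s₂|`. -/
abbrev PosReal : Type := Ioi (0 : ℝ)

instance : LocallyCompactSpace PosReal := isOpen_Ioi.locallyCompactSpace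

/-- The space `ℝ₊* × X`. -/
abbrev Marked (X : Type*) : Type _ := PosReal × X

theorem eq_sum_of_compl_null {X : Type*} [MeasurableSpace X] [MeasurableSingletonClass X]
    (η : Measure X) (A : Set X) (hA : A.Countable) (h0 : η Aᶜ = 0) :
    η = Measure.sum fun x : A => η {(x : X)} • Measure.dirac (x : X) := by
  have : Countable A := hA
  have h1 : η.restrict A = η := by
    have := Measure.restrict_add_restrict_compl (μ := η) hA.measurableSet
    rwa [Measure.restrict_eq_zero.2 h0, add_zero] at this
  have h2 : (⋃ x : A, {(x : X)}) = A := by simp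
  have h3 := Measure.restrict_iUnion (μ := η) (s := fun x : A => {(x : X)})
    (fun x y hxy => by simpa [Function.onFun, Subtype.ext_iff] using hxy)
    (fun x => measurableSet_singleton _)
  rw [h2, h1] at h3
  simpa using h3

theorem exists_atoms_of_compl_null {X : Type*} [MeasurableSpace X] [MeasurableSingletonClass X]
    (η : Measure X) (hη : ∀ x, η {x} < ∞) (A : Set X) (hA : A.Countable) (h0 : η Aᶜ = 0) :
    ∃ (A : Set X) (s : X → ℝ), A.Countable ∧ (∀ x ∈ A, 0 < s x) ∧
      η = Measure.sum fun x : A => ENNReal.ofReal (s x) • Measure.dirac (x : X) := by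
  have h1 : η {x ∈ A | η {x} ≠ 0}ᶜ = 0 := by
    have h2 : {x ∈ A | η {x} ≠ 0}ᶜ ⊆ Aᶜ ∪ ⋃ x ∈ {x ∈ A | η {x} = 0}, {x} := by
      intro x hx
      by_cases h : x ∈ A
      · right
        simp only [mem_compl_iff, mem_ofPred_eq, not_and, not_not] at hx
        simpa using ⟨h, hx h⟩
      · exact Or.inl h
    refine measure_mono_null h2 (measure_union_null h0 ?_)
    rw [measure_biUnion_null_iff (hA.mono (sep_subset _ _))]
    exact fun x hx => hx.2
  refine ⟨{x ∈ A | η {x} ≠ 0}, fun x => (η {x}).toReal, hA.mono (sep_subset _ _),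
    fun x hx => ENNReal.toReal_pos hx.2 (hη x).ne, ?_⟩
  conv_lhs => rw [eq_sum_of_compl_null η _ (hA.mono (sep_subset _ _)) h1]
  congr with x
  rw [ENNReal.ofReal_toReal (hη x).ne]

namespace Cone

variable {X : Type*} [TopologicalSpace X] [MeasurableSpace X]

/-- The vague topology, induced by the maps `η ↦ ⟨η, f⟩ = ∫ f dη`, `f ∈ C_c(X)`. -/
instance : TopologicalSpace (Cone X) :=
  ⨅ f : C_c(X, ℝ), TopologicalSpace.induced (fun η => ∫ x, f x ∂η.toMeasure) inferInstance

instance : MeasurableSpace (Cone X) := borel _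

/-- The support `τ(η) = {x | η({x}) > 0}`. -/
def supp (η : Cone X) : Set X := {x | 0 < η.toMeasure {x}}

theorem singleton_lt_top (η : Cone X) (x : X) : η.toMeasure {x} < ∞ :=
  η.lt_top_of_isCompact _ isCompact_singleton

variable [MeasurableSingletonClass X]

theorem exists_countable (η : Cone X) : η.supp.Countable ∧ η.toMeasure η.suppᶜ = 0 := by
  obtain ⟨A, s, hA, hs, h⟩ := η.exists_atoms
  have : Countable A := hA
  have h0 : η.toMeasure Aᶜ = 0 := by
    rw [h, Measure.sum_apply _ hA.measurableSet.compl]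
    simp
  have h1 : η.supp = A := by
    ext x
    constructor
    · intro hx
      by_contra hxA
      exact hx.ne' (measure_mono_null (singleton_subset_iff.2 hxA) h0)
    · intro hx
      change 0 < η.toMeasure {x}
      rw [h, Measure.sum_apply _ (measurableSet_singleton x)]
      refine lt_of_lt_of_le ?_ (ENNReal.le_tsum (⟨x, hx⟩ : A))
      simpa using hs x hx
  rw [h1]
  exact ⟨hA, h0⟩

theorem countable_supp (η : Cone X) : η.supp.Countable := η.exists_countable.1

theorem compl_supp (η : Cone X) : η.toMeasure η.suppᶜ = 0 := η.exists_countable.2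

/-- The measure `η - s_x δ_x`, where `s_x = η({x})`: the atom at `x` is removed (and nothing
happens if `x` is not an atom). -/
def remove (η : Cone X) (x : X) : Cone X where
  toMeasure := η.toMeasure.restrict {x}ᶜ
  lt_top_of_isCompact K hK :=
    (Measure.restrict_apply_le _ _).trans_lt (η.lt_top_of_isCompact K hK)
  exists_atoms := exists_atoms_of_compl_null _
    (fun y => (Measure.restrict_apply_le _ _).trans_lt (η.singleton_lt_top y)) η.supp
    η.countable_supp (le_antisymm ((Measure.restrict_apply_le _ _).trans η.compl_supp.le) bot_le)

/-- Removing the atom at `x` is the subtraction of `s_x δ_x`. -/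
theorem remove_add (η : Cone X) (x : X) :
    (η.remove x).toMeasure + η.toMeasure {x} • Measure.dirac x = η.toMeasure := by
  rw [← Measure.restrict_singleton]
  exact Measure.restrict_compl_add_restrict (measurableSet_singleton x)

/-- The measure `η + s δ_x`, where `p = (s, x)`. -/
def add (η : Cone X) (p : Marked X) : Cone X where
  toMeasure := η.toMeasure + ENNReal.ofReal p.1 • Measure.dirac p.2
  lt_top_of_isCompact K hK := by
    rw [Measure.add_apply, Measure.smul_apply, smul_eq_mul]
    exact ENNReal.add_lt_top.2 ⟨η.lt_top_of_isCompact K hK,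
      ENNReal.mul_lt_top ENNReal.ofReal_lt_top (measure_lt_top _ _)⟩
  exists_atoms := by
    refine exists_atoms_of_compl_null _ (fun y => ?_) (η.supp ∪ {p.2})
      (η.countable_supp.union (countable_singleton _)) ?_
    · rw [Measure.add_apply, Measure.smul_apply, smul_eq_mul]
      exact ENNReal.add_lt_top.2 ⟨η.singleton_lt_top y,
        ENNReal.mul_lt_top ENNReal.ofReal_lt_top (measure_lt_top _ _)⟩
    · rw [Measure.add_apply, Measure.smul_apply, smul_eq_mul]
      have h1 : η.toMeasure (η.supp ∪ {p.2})ᶜ = 0 :=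
        measure_mono_null (compl_subset_compl.2 subset_union_left) η.compl_supp
      have h2 : Measure.dirac p.2 (η.supp ∪ {p.2})ᶜ = 0 := by
        rw [Measure.dirac_apply' _
          (η.countable_supp.union (countable_singleton _)).measurableSet.compl]
        simp
      rw [h1, h2, mul_zero, add_zero]

end Cone

/-! ### Pinpointing configurations and the bijection `ℛ : Π(ℝ₊* × X) → 𝕂(X)` -/

section Bijection

variable {X : Type*} [TopologicalSpace X]

/-- The local mass `γ(Λ) = ∑_{(s, x) ∈ γ} s 1_Λ(x)`. -/
def localMass (γ : Config (Marked X)) (Λ : Set X) : ℝ≥0∞ :=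
  ∑' p : γ.points, Λ.indicator (fun _ => ENNReal.ofReal p.1.1) p.1.2

/-- The set `Π(ℝ₊* × X)` of pinpointing configurations with finite local mass. -/
def pinpointing (X : Type*) [TopologicalSpace X] [MeasurableSpace X] :
    Set (Config (Marked X)) :=
  {γ | (∀ p ∈ γ.points, ∀ q ∈ γ.points, p.2 = q.2 → p.1 = q.1) ∧
    ∀ Λ : Set X, MeasurableSet Λ → IsCompact (closure Λ) → localMass γ Λ < ∞}

variable [PolishSpace X] [LocallyCompactSpace X] [MeasurableSpace X] [BorelSpace X]

/-- The measure `∑_{(s, x) ∈ γ} s δ_x`. -/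
def weightedMeasure (γ : Config (Marked X)) : Measure X :=
  Measure.sum fun p : γ.points => ENNReal.ofReal p.1.1 • Measure.dirac p.1.2

theorem weightedMeasure_apply (γ : Config (Marked X)) {Λ : Set X} (hΛ : MeasurableSet Λ) :
    weightedMeasure γ Λ = localMass γ Λ := by
  rw [weightedMeasure, Measure.sum_apply _ hΛ, localMass]
  congr with p
  by_cases h : p.1.2 ∈ Λ <;> simp [h, Measure.dirac_apply' _ hΛ]

theorem weightedMeasure_singleton {γ : Config (Marked X)} (hγ : γ ∈ pinpointing X)
    {p : Marked X} (hp : p ∈ γ.points) :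
    weightedMeasure γ {p.2} = ENNReal.ofReal p.1 := by
  rw [weightedMeasure_apply γ (measurableSet_singleton _), localMass,
    tsum_eq_single (⟨p, hp⟩ : γ.points)]
  · simp
  · intro q hq
    refine indicator_of_notMem (fun h => hq ?_) _
    exact Subtype.ext (Prod.ext (hγ.1 _ q.2 _ hp h) h)

/-- The map `ℛ(∑ δ_{(s, x)}) = ∑ s δ_x`. -/
def toCone (γ : pinpointing X) : Cone X where
  toMeasure := weightedMeasure γ.1
  lt_top_of_isCompact K hK := by
    rw [weightedMeasure_apply _ hK.measurableSet]
    exact γ.2.2 K hK.measurableSet (by rwa [hK.isClosed.closure_eq])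
  exists_atoms := by
    refine exists_atoms_of_compl_null _ (fun x => ?_) (Prod.snd '' γ.1.points)
      (γ.1.countable.image _) ?_
    · rw [weightedMeasure_apply _ (measurableSet_singleton x)]
      exact γ.2.2 {x} (measurableSet_singleton x) (by simp)
    · rw [weightedMeasure_apply _ (γ.1.countable.image _).measurableSet.compl, localMass,
        ENNReal.tsum_eq_zero]
      intro p
      refine indicator_of_notMem ?_ _
      simpa using ⟨p.1.1, p.1.1.2, p.2⟩

/-- The configuration `{(s_x, x) | x ∈ τ(η)}`, where `s_x = η({x})`. -/
def markedPoints (η : Cone X) : Config (Marked X) where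
  points := {p | η.toMeasure {p.2} = ENNReal.ofReal p.1}
  finite_inter K hK := by
    have hK2 : IsCompact (Prod.snd '' K) := hK.image continuous_snd
    obtain rfl | hne := K.eq_empty_or_nonempty
    · simp
    obtain ⟨q, hq, hmin⟩ := hK.exists_isMinOn hne
      (f := fun p : Marked X => (p.1 : ℝ)) (by fun_prop)
    have hfin : {x : Prod.snd '' K | ENNReal.ofReal q.1 ≤ η.toMeasure {(x : X)}}.Finite := by
      refine ENNReal.finite_const_le_of_tsum_ne_top (ne_of_lt ?_)
        (ENNReal.ofReal_pos.2 q.1.2).ne'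
      refine lt_of_le_of_lt (tsum_meas_le_meas_iUnion_of_disjoint _
        (fun x => measurableSet_singleton _) (fun x y hxy => ?_))
        (lt_of_eq_of_lt ?_ (η.lt_top_of_isCompact _ hK2))
      · simpa [Function.onFun, Subtype.ext_iff] using hxy
      · rw [iUnion_of_singleton_coe]
    refine Set.Finite.of_finite_image (f := Prod.snd)
      ((hfin.image (Subtype.val : Prod.snd '' K → X)).subset ?_) ?_
    · rintro _ ⟨p, ⟨hp, hpK⟩, rfl⟩
      refine ⟨⟨p.2, p, hpK, rfl⟩, ?_, rfl⟩
      change _ ≤ η.toMeasure {p.2}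
      rw [show η.toMeasure {p.2} = ENNReal.ofReal p.1 from hp]
      exact ENNReal.ofReal_le_ofReal (hmin hpK)
    · rintro p ⟨hp, -⟩ q ⟨hq, -⟩ h
      have h1 : ENNReal.ofReal p.1 = ENNReal.ofReal q.1 := by
        rw [← show η.toMeasure {p.2} = ENNReal.ofReal p.1 from hp,
          ← show η.toMeasure {q.2} = ENNReal.ofReal q.1 from hq, h]
      exact Prod.ext (Subtype.ext ((ENNReal.ofReal_eq_ofReal_iff (le_of_lt p.1.2)
        (le_of_lt q.1.2)).1 h1)) h

theorem weightedMeasure_markedPoints (η : Cone X) :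
    weightedMeasure (markedPoints η) = η.toMeasure := by
  have hpos : ∀ x : η.supp, 0 < (η.toMeasure {(x : X)}).toReal := fun x =>
    ENNReal.toReal_pos (ne_of_gt x.2) (η.singleton_lt_top x).ne
  have hof : ∀ x : X, ENNReal.ofReal (η.toMeasure {x}).toReal = η.toMeasure {x} := fun x =>
    ENNReal.ofReal_toReal (η.singleton_lt_top x).ne
  let e : η.supp ≃ (markedPoints η).points :=
    { toFun := fun x => ⟨(⟨(η.toMeasure {(x : X)}).toReal, hpos x⟩, x), (hof x).symm⟩
      invFun := fun p => ⟨p.1.2, by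
        have h : η.toMeasure {p.1.2} = ENNReal.ofReal p.1.1 := p.2
        change 0 < η.toMeasure {p.1.2}
        rw [h]
        exact ENNReal.ofReal_pos.2 p.1.1.2⟩
      left_inv := fun x => rfl
      right_inv := fun p => by
        have h : η.toMeasure {p.1.2} = ENNReal.ofReal p.1.1 := p.2
        refine Subtype.ext (Prod.ext (Subtype.ext ?_) rfl)
        change (η.toMeasure {p.1.2}).toReal = _
        rw [h, ENNReal.toReal_ofReal (le_of_lt p.1.1.2)] }
  conv_rhs => rw [eq_sum_of_compl_null η.toMeasure _ η.countable_supp η.compl_supp]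
  ext t ht
  rw [weightedMeasure, Measure.sum_apply _ ht, Measure.sum_apply _ ht, ← e.tsum_eq]
  congr with x
  change (ENNReal.ofReal (η.toMeasure {(x : X)}).toReal • Measure.dirac (x : X)) t = _
  rw [hof]

/-- The bijection `ℛ : Π(ℝ₊* × X) → 𝕂(X)`, `∑ δ_{(s, x)} ↦ ∑ s δ_x`; its inverse is
`η ↦ {(s_x, x) | x ∈ τ(η)}`. -/
def coneEquiv (X : Type*) [TopologicalSpace X] [PolishSpace X] [LocallyCompactSpace X]
    [MeasurableSpace X] [BorelSpace X] : pinpointing X ≃ Cone X where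
  toFun := toCone
  invFun η := ⟨markedPoints η, by
    refine ⟨fun p hp q hq h => ?_, fun Λ hΛ hc => ?_⟩
    · have h1 : ENNReal.ofReal p.1 = ENNReal.ofReal q.1 := by
        rw [← show η.toMeasure {p.2} = ENNReal.ofReal p.1 from hp,
          ← show η.toMeasure {q.2} = ENNReal.ofReal q.1 from hq, h]
      exact Subtype.ext ((ENNReal.ofReal_eq_ofReal_iff (le_of_lt p.1.2) (le_of_lt q.1.2)).1 h1)
    · rw [← weightedMeasure_apply _ hΛ, weightedMeasure_markedPoints]
      exact (measure_mono subset_closure).trans_lt (η.lt_top_of_isCompact _ hc)⟩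
  left_inv γ := by
    refine Subtype.ext (Config.ext (Set.ext fun p => ?_))
    change weightedMeasure γ.1 {p.2} = ENNReal.ofReal p.1 ↔ p ∈ γ.1.points
    refine ⟨fun h => ?_, fun h => weightedMeasure_singleton γ.2 h⟩
    have h0 : weightedMeasure γ.1 {p.2} ≠ 0 := by
      rw [h]
      exact (ENNReal.ofReal_pos.2 p.1.2).ne'
    rw [weightedMeasure_apply _ (measurableSet_singleton _), localMass, Ne,
      ENNReal.tsum_eq_zero, not_forall] at h0
    obtain ⟨q, hq⟩ := h0
    have hq2 : q.1.2 = p.2 := by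
      by_contra hne
      exact hq (indicator_of_notMem (show q.1.2 ∉ ({p.2} : Set X) from hne) _)
    have h1 := weightedMeasure_singleton γ.2 q.2
    rw [hq2, h] at h1
    have h2 : p = q.1 := Prod.ext (Subtype.ext ((ENNReal.ofReal_eq_ofReal_iff (le_of_lt p.1.2)
      (le_of_lt q.1.1.2)).1 h1)) hq2.symm
    rw [h2]
    exact q.2
  right_inv η := Cone.ext (weightedMeasure_markedPoints η)

end Bijection

/-! ### Cylinder functions, discrete gradients and the Dirichlet form -/

variable {X : Type*} [TopologicalSpace X] [PolishSpace X] [LocallyCompactSpace X]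
  [MeasurableSpace X] [BorelSpace X]

/-- The probability measure `π_{𝕂, ν ⊗ σ}` on `𝕂(X)`: the push-forward under `ℛ` of the
restriction to `Π(ℝ₊* × X)` of the Poisson measure with intensity `ν ⊗ σ`. -/
def poissonCone (ν : Measure PosReal) (σ : Measure X) [IsFiniteMeasureOnCompacts ν]
    [IsFiniteMeasureOnCompacts σ] : Measure (Cone X) :=
  ((poissonConfig (ν.prod σ)).comap (Subtype.val : pinpointing X → Config (Marked X))).map
    (coneEquiv X)

/-- The pairing `⟨ℛ⁻¹ η, φ⟩`. -/
def pairing (η : Cone X) (φ : C_c(Marked X, ℝ)) : ℝ :=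
  ∫ p, φ p ∂((coneEquiv X).symm η).1.toMeasure

/-- The space of cylinder functions `η ↦ g(⟨ℛ⁻¹ η, φ₁⟩, …, ⟨ℛ⁻¹ η, φ_N⟩)` with
`g ∈ C_b(ℝ^N)`, `φ₁, …, φ_N ∈ C_c(ℝ₊* × X)`, `N ≥ 1`. -/
def cylinderFunctions (X : Type*) [TopologicalSpace X] [PolishSpace X] [LocallyCompactSpace X]
    [MeasurableSpace X] [BorelSpace X] : Submodule ℝ (Cone X → ℝ) where
  carrier := {F | ∃ (N : ℕ) (_ : 1 ≤ N) (g : (Fin N → ℝ) →ᵇ ℝ) (φ : Fin N → C_c(Marked X, ℝ)),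
    ∀ η, F η = g fun i => pairing η (φ i)}
  zero_mem' := ⟨1, le_rfl, 0, 0, fun _ => rfl⟩
  add_mem' := by
    rintro F G ⟨N, hN, g, φ, hF⟩ ⟨M, hM, g', φ', hG⟩
    refine ⟨N + M, by omega,
      g.compContinuous ⟨fun v i => v (Fin.castAdd M i), by fun_prop⟩ +
        g'.compContinuous ⟨fun v i => v (Fin.natAdd N i), by fun_prop⟩,
      Fin.append φ φ', fun η => ?_⟩
    simp [hF, hG]
  smul_mem' := by
    rintro c F ⟨N, hN, g, φ, hF⟩
    exact ⟨N, hN, c • g, φ, fun η => by simp [hF]⟩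

/-- The discrete death gradient `(D_x^- F)(η) = F(η - s_x δ_x) - F(η)`. It is used for
`x ∈ τ(η)`, and vanishes for other `x`. -/
def deathGradient (F : Cone X → ℝ) (η : Cone X) (x : X) : ℝ := F (η.remove x) - F η

/-- The discrete birth gradient `(D_{(s, x)}^+ F)(η) = F(η + s δ_x) - F(η)`. -/
def birthGradient (F : Cone X → ℝ) (η : Cone X) (p : Marked X) : ℝ := F (η.add p) - F η

/-- The measure `s ν(ds) ⊗ σ(dx)` on `ℝ₊* × X`. -/
def birthMeasure (ν : Measure PosReal) (σ : Measure X) : Measure (Marked X) :=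
  (ν.withDensity fun s => ENNReal.ofReal s).prod σ

/-- The inner product `⟨D^- F, D^- G⟩` at `η` in the tangent space `L²(X, η)`. -/
def deathInner (F G : Cone X → ℝ) (η : Cone X) : ℝ :=
  ∫ x, deathGradient F η x * deathGradient G η x ∂η.toMeasure

/-- The inner product `⟨D^+ F, D^+ G⟩` at `η` in the tangent space
`L²(ℝ₊* × X, s ν(ds) ⊗ σ(dx))`. -/
def birthInner (ν : Measure PosReal) (σ : Measure X) (F G : Cone X → ℝ) (η : Cone X) : ℝ :=
  ∫ p, birthGradient F η p * birthGradient G η p ∂(birthMeasure ν σ)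

/-- The Dirichlet integral `ℰ(F, G)` of the discrete death gradient. -/
def dirichletForm (ν : Measure PosReal) (σ : Measure X) [IsFiniteMeasureOnCompacts ν]
    [IsFiniteMeasureOnCompacts σ] (F G : Cone X → ℝ) : ℝ :=
  ∫ η, deathInner F G η ∂(poissonCone ν σ)

/-- The Dirichlet integral of the discrete birth gradient. -/
def birthDirichletForm (ν : Measure PosReal) (σ : Measure X) [IsFiniteMeasureOnCompacts ν]
    [IsFiniteMeasureOnCompacts σ] (F G : Cone X → ℝ) : ℝ :=
  ∫ η, birthInner ν σ F G η ∂(poissonCone ν σ)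

end

/-! ### The Borel σ-algebra of the vague topology -/

section Vague

open Filter Topology

variable {E : Type*} [TopologicalSpace E] [T2Space E] [LocallyCompactSpace E]

/-! Everything rests on the Mecke formula: under a Poisson measure, the expected sum over the points
`p` of a configuration of a function of `p` and the remaining points equals the expectation, over an
unchanged configuration, of that function integrated in `p` against the intensity.

Through `markedPoints`, the inverse of ℛ, a cylinder function is `g(I)`, where `I` is the vector of
integrals of the `φ i`. Removing the atom of the marked point `p = (s, x)` gives `g(I - φ(p))`,
adding a new one gives `g(I + φ(p))`. Put `h(v, p) = s (g(v + φ(p)) - g(v)) (g'(v + φ(p)) - g'(v))`.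
The death inner product is the sum of `h(I - φ(p), p)` over the marked points, the birth inner
product is the integral of `h(I, p)` against ν ⊗ σ, and `integral_mecke` equates their expectations.
Integrability holds because the `φ i` vanish outside `ℝ₊* × K` for a compact `K`, on which `s ν ⊗ σ`
has finite mass.

The form descends to classes by the same formula: if `g(I) = 0` almost surely, then Mecke for an
indicator gives `g(I + φ(p)) = 0` for almost all configurations and points, so the birth gradient
vanishes almost everywhere (`dirichletForm_eq_zero_of_ae_eq_zero`). Bilinearity gives the rest.

The Poisson measure is the image of a sequence of independent finite Poisson lists, so Mecke is
proved for one list, then for one list within the sequence, then summed over the cells.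
Measurability of all maps between sequences, configurations and cones relies on `borel_vague`, which
identifies the vague Borel σ-algebra with the one generated by evaluations. Mecke also shows that
points have distinct positions almost surely, and its special case, the Campbell formula, that local
masses are finite; hence ℛ is defined almost everywhere and π is a probability measure. -/

theorem exists_cutoff {K : Set E} (hK : IsCompact K) :
    ∃ ψ : C_c(E, ℝ), (∀ x ∈ K, ψ x = 1) ∧ ∀ x, ψ x ∈ Icc (0 : ℝ) 1 := by
  obtain ⟨f, h1, -, h3, h4⟩ :=
    exists_continuous_one_zero_of_isCompact hK isClosed_empty (disjoint_empty K)
  exact ⟨⟨f, h3⟩, h1, h4⟩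

variable [SecondCountableTopology E]

/-- A countable family of compactly supported functions which approximates all others. -/
theorem exists_countable_approx (E : Type*) [TopologicalSpace E] [T2Space E]
    [LocallyCompactSpace E] [SecondCountableTopology E] :
    ∃ S : Set C_c(E, ℝ), S.Countable ∧ ∀ f : C_c(E, ℝ), ∃ ψ ∈ S, ∀ ε > 0, ∃ g ∈ S,
      ∀ x, |f x - g x| ≤ ε * ψ x := by
  have hcut : ∀ n, ∃ ψ : C_c(E, ℝ), (∀ x ∈ CompactExhaustion.choice E n, ψ x = 1) ∧
      ∀ x, ψ x ∈ Icc (0 : ℝ) 1 := fun n =>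
    exists_cutoff ((CompactExhaustion.choice E).isCompact n)
  choose ψ hψ1 hψ2 using hcut
  let A : ℕ → Set C_c(E, ℝ) := fun n => {f | ∀ x ∉ CompactExhaustion.choice E n, f x = 0}
  have hdense : ∀ n, ∃ S ⊆ A n, S.Countable ∧ ∀ f ∈ A n, ∀ ε > 0, ∃ g ∈ S,
      ∀ x ∈ CompactExhaustion.choice E n, |f x - g x| < ε := by
    intro n
    let A' : Set C(E, ℝ) := (fun f : C_c(E, ℝ) => f.toContinuousMap) '' A n
    obtain ⟨c, hc, hcA, hd⟩ := TopologicalSpace.IsSeparable.exists_countable_dense_subset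
      (TopologicalSpace.IsSeparable.of_separableSpace A')
    -- One compactly supported preimage is kept for each element of the countable dense set `c`.
    obtain ⟨S, hSA, hbij⟩ := SurjOn.exists_bijOn_subset hc
    have hSc := hbij.image_eq
    have hSinj := hbij.injOn
    refine ⟨S, hSA, countable_of_injective_of_countable_image hSinj (hSc ▸ hcA), ?_⟩
    intro f hf ε hε
    have hfc : f.toContinuousMap ∈ closure c := hd ⟨f, hf, rfl⟩
    have hn : {g : C(E, ℝ) | ∀ x ∈ CompactExhaustion.choice E n, dist (f x) (g x) < ε} ∈
        𝓝 f.toContinuousMap := by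
      have := (ContinuousMap.tendsto_iff_forall_isCompact_tendstoUniformlyOn
        (f := f.toContinuousMap) (F := fun g : C(E, ℝ) => g)).1 tendsto_id _
        ((CompactExhaustion.choice E).isCompact n)
      exact Metric.tendstoUniformlyOn_iff.1 this ε hε
    obtain ⟨g, hg1, hg2⟩ := mem_closure_iff_nhds.1 hfc _ hn
    rw [← hSc] at hg2
    obtain ⟨g, hg, rfl⟩ := hg2
    exact ⟨g, hg, hg1⟩
  choose S hSA hSc hS using hdense
  refine ⟨range ψ ∪ ⋃ n, S n, (countable_range ψ).union (countable_iUnion hSc), fun f => ?_⟩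
  obtain ⟨n, hn⟩ := (CompactExhaustion.choice E).exists_superset_of_isCompact
    f.hasCompactSupport
  have hf : f ∈ A n := fun x hx => image_eq_zero_of_notMem_tsupport fun h => hx (hn h)
  -- The cutoff does not depend on ε: its integral can be bounded before the accuracy is chosen, as
  -- in `vague_eq_iInf_countable`.
  refine ⟨ψ n, Or.inl ⟨n, rfl⟩, fun ε hε => ?_⟩
  obtain ⟨g, hg, hfg⟩ := hS n f hf ε hε
  refine ⟨g, Or.inr (mem_iUnion.2 ⟨n, hg⟩), fun x => ?_⟩
  by_cases hx : x ∈ CompactExhaustion.choice E n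
  · rw [hψ1 n x hx, mul_one]
    exact (hfg x hx).le
  · rw [hf x hx, hSA n hg x hx, sub_zero, abs_zero]
    exact mul_nonneg hε.le (hψ2 n x).1

variable [MeasurableSpace E] [BorelSpace E]

theorem CompactlySupportedContinuousMap.integrable_of_finite_on_compacts (f : C_c(E, ℝ))
    (μ : Measure E) [IsFiniteMeasureOnCompacts μ] : Integrable f μ :=
  f.continuous.integrable_of_hasCompactSupport f.hasCompactSupport

variable {T : Type*} {m : T → Measure E}

/-- Multiplying by a cutoff makes the measures finite, so a π-system argument over closed sets
applies. The mass of a closed set is the limit of integrals of continuous approximations to its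
indicator, which the cutoff makes compactly supported. An exhaustion, on whose members the cutoffs
equal 1, then recovers the original measures. -/
theorem measurable_of_measurable_integral [MeasurableSpace T]
    [∀ t, IsFiniteMeasureOnCompacts (m t)]
    (h : ∀ f : C_c(E, ℝ), Measurable fun t => ∫ x, f x ∂(m t)) : Measurable m := by
  have hnn : ∀ f : C_c(E, ℝ), (∀ x, 0 ≤ f x) →
      Measurable fun t => ∫⁻ x, ENNReal.ofReal (f x) ∂(m t) := by
    intro f hf
    have : (fun t => ∫⁻ x, ENNReal.ofReal (f x) ∂(m t)) =
        fun t => ENNReal.ofReal (∫ x, f x ∂(m t)) := by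
      ext t
      rw [ofReal_integral_eq_lintegral_ofReal (f.integrable_of_finite_on_compacts _)
        (Eventually.of_forall hf)]
    rw [this]
    exact (h f).ennreal_ofReal
  choose ψ hψ1 hψ2 using fun n : ℕ =>
    exists_cutoff ((CompactExhaustion.choice E).isCompact n)
  have hfin : ∀ n t, IsFiniteMeasure ((m t).withDensity fun x => ENNReal.ofReal (ψ n x)) := by
    intro n t
    exact isFiniteMeasure_withDensity_ofReal
      ((ψ n).integrable_of_finite_on_compacts (m t)).2
  have hd : ∀ n, Measurable fun t => (m t).withDensity fun x => ENNReal.ofReal (ψ n x) := by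
    intro n
    refine Measurable.measure_of_isPiSystem
      ((BorelSpace.measurable_eq (α := E)).trans borel_eq_generateFrom_isClosed)
      (isPiSystem_isClosed) ?_ ?_
    · intro F hF
      refine measurable_of_tendsto_metrizable (f := fun k t => ∫⁻ x, hF.apprSeq k x
        ∂((m t).withDensity fun x => ENNReal.ofReal (ψ n x))) (fun k => ?_) ?_
      · let f : C_c(E, ℝ) := ⟨⟨fun x => ψ n x * (hF.apprSeq k x : ℝ), by fun_prop⟩,
          (ψ n).hasCompactSupport.mul_right⟩
        convert hnn f (fun x => mul_nonneg (hψ2 n x).1 NNReal.zero_le_coe) using 2 with t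
        rw [lintegral_withDensity_eq_lintegral_mul₀ (by fun_prop) (by fun_prop)]
        refine lintegral_congr fun x => ?_
        change _ = ENNReal.ofReal (ψ n x * (hF.apprSeq k x : ℝ))
        rw [ENNReal.ofReal_mul (hψ2 n x).1]
        simp
      · rw [tendsto_pi_nhds]
        intro t
        exact HasOuterApproxClosed.tendsto_lintegral_apprSeq hF _
    · simp only [withDensity_apply _ MeasurableSet.univ, Measure.restrict_univ]
      exact hnn (ψ n) fun x => (hψ2 n x).1
  refine Measure.measurable_of_measurable_coe _ fun B hB => ?_
  have hB' : ∀ t, m t B = ⨆ n, ((m t).withDensity fun x => ENNReal.ofReal (ψ n x))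
      (B ∩ CompactExhaustion.choice E n) := by
    intro t
    have h1 : ∀ n, ((m t).withDensity fun x => ENNReal.ofReal (ψ n x))
        (B ∩ CompactExhaustion.choice E n) = m t (B ∩ CompactExhaustion.choice E n) := by
      intro n
      have hm : MeasurableSet (B ∩ CompactExhaustion.choice E n) :=
        hB.inter ((CompactExhaustion.choice E).isCompact n).measurableSet
      rw [withDensity_apply _ hm, setLIntegral_congr_fun (g := 1) hm, Pi.one_def,
        setLIntegral_one]
      intro x hx
      simp [hψ1 n x hx.2]
    simp_rw [h1]
    rw [← Monotone.measure_iUnion, ← inter_iUnion, CompactExhaustion.iUnion_eq, inter_univ]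
    intro i j hij
    exact inter_subset_inter_right _ ((CompactExhaustion.choice E).subset hij)
  simp_rw [hB']
  exact Measurable.iSup fun n => (Measure.measurable_coe
    (hB.inter ((CompactExhaustion.choice E).isCompact n).measurableSet)).comp (hd n)

theorem measurable_integral_of_measurable [MeasurableSpace T]
    [∀ t, IsFiniteMeasureOnCompacts (m t)] (hm : Measurable m) (f : C_c(E, ℝ)) :
    Measurable fun t => ∫ x, f x ∂(m t) := by
  simp_rw [integral_eq_lintegral_pos_part_sub_lintegral_neg_part
    (f.integrable_of_finite_on_compacts _)]
  have h : ∀ g : E → ℝ≥0∞, Measurable g → Measurable fun t => ∫⁻ x, g x ∂(m t) :=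
    fun g hg => (Measure.measurable_lintegral hg).comp hm
  exact (h _ (by fun_prop)).ennreal_toReal.sub (h _ (by fun_prop)).ennreal_toReal

/-- The vague topology is induced by countably many integrals. -/
theorem vague_eq_iInf_countable [∀ t, IsFiniteMeasureOnCompacts (m t)] :
    ∃ S : Set C_c(E, ℝ), S.Countable ∧
      (⨅ f : C_c(E, ℝ), TopologicalSpace.induced (fun t => ∫ x, f x ∂(m t)) inferInstance) =
      ⨅ f : S, TopologicalSpace.induced (fun t => ∫ x, f.1 x ∂(m t)) inferInstance := by
  obtain ⟨S, hS, happ⟩ := exists_countable_approx E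
  refine ⟨S, hS, le_antisymm (le_iInf fun f => iInf_le _ f.1) (le_iInf fun f => ?_)⟩
  let _ : TopologicalSpace T :=
    ⨅ f : S, TopologicalSpace.induced (fun t => ∫ x, f.1 x ∂(m t)) inferInstance
  have hc : ∀ g ∈ S, Continuous fun t => ∫ x, g x ∂(m t) := fun g hg =>
    continuous_iff_le_induced.2 (iInf_le _ (⟨g, hg⟩ : S))
  refine continuous_iff_le_induced.1 ?_
  obtain ⟨ψ, hψ, hf⟩ := happ f
  refine continuous_of_locally_uniform_approx_of_continuousAt fun t u hu => ?_
  obtain ⟨ε, hε, hεu⟩ := Metric.mem_uniformity_dist.1 hu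
  -- `C` bounds the integral of ψ on a whole neighbourhood of `t`, so an error of at most `ε / (2C)
  -- · ψ` integrates to less than ε there.
  obtain ⟨C, hC⟩ : ∃ C, C = |∫ x, ψ x ∂(m t)| + 1 := ⟨_, rfl⟩
  have hC0 : 0 < C := by rw [hC]; positivity
  obtain ⟨g, hg, hfg⟩ := hf (ε / (2 * C)) (by positivity)
  refine ⟨{t' | ∫ x, ψ x ∂(m t') < C}, ?_, fun t' => ∫ x, g x ∂(m t'), (hc g hg).continuousAt,
    fun t' ht' => hεu ?_⟩
  · refine (isOpen_lt (hc ψ hψ) continuous_const).mem_nhds ?_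
    change ∫ x, ψ x ∂(m t) < C
    rw [hC]
    linarith [le_abs_self (∫ x, ψ x ∂(m t))]
  · have hif := f.integrable_of_finite_on_compacts (m t')
    have hig := g.integrable_of_finite_on_compacts (m t')
    have hiψ := ψ.integrable_of_finite_on_compacts (m t')
    rw [Real.dist_eq, ← integral_sub hif hig]
    calc |∫ x, f x - g x ∂(m t')| ≤ ∫ x, |f x - g x| ∂(m t') := abs_integral_le_integral_abs
      _ ≤ ∫ x, ε / (2 * C) * ψ x ∂(m t') :=
        integral_mono (hif.sub hig).abs (hiψ.const_mul _) hfg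
      _ = ε / (2 * C) * ∫ x, ψ x ∂(m t') := integral_const_mul _ _
      _ ≤ ε / (2 * C) * C := by
        have : ∫ x, ψ x ∂(m t') < C := ht'
        gcongr
      _ < ε := by
        have : ε / (2 * C) * C = ε / 2 := by field_simp
        rw [this]
        linarith

/-- The Borel σ-algebra of the vague topology is the one generated by the evaluations. -/
theorem borel_vague [∀ t, IsFiniteMeasureOnCompacts (m t)] :
    @borel T (⨅ f : C_c(E, ℝ),
      TopologicalSpace.induced (fun t => ∫ x, f x ∂(m t)) inferInstance) =
      MeasurableSpace.comap m inferInstance := by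
  refine le_antisymm ?_ ?_
  · obtain ⟨S, hS, h⟩ := vague_eq_iInf_countable (m := m)
    have : Countable S := hS
    have h2 : (⨅ f : S, TopologicalSpace.induced (fun t => ∫ x, f.1 x ∂(m t)) inferInstance) =
        TopologicalSpace.induced (fun t (f : S) => ∫ x, f.1 x ∂(m t)) inferInstance := by
      rw [Pi.topologicalSpace, induced_iInf]
      simp_rw [induced_compose]
      rfl
    -- Countability of `S` enters here: on a countable product of lines the Borel σ-algebra is the
    -- product σ-algebra, so coordinates can be checked separately.
    rw [h, h2, borel_comap, ← BorelSpace.measurable_eq (α := S → ℝ)]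
    let _ : MeasurableSpace T := MeasurableSpace.comap m inferInstance
    exact Measurable.comap_le (measurable_pi_lambda _ fun f =>
      measurable_integral_of_measurable (comap_measurable m) f.1)
  · let : TopologicalSpace T :=
      ⨅ f : C_c(E, ℝ), TopologicalSpace.induced (fun t => ∫ x, f x ∂(m t)) inferInstance
    let _ : MeasurableSpace T := borel T
    have : BorelSpace T := ⟨rfl⟩
    refine Measurable.comap_le (measurable_of_measurable_integral fun f => ?_)
    exact Continuous.measurable (continuous_iff_le_induced.2 (iInf_le _ f))

end Vague

namespace Config

variable {E : Type*} [TopologicalSpace E] [MeasurableSpace E]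

instance [T2Space E] [SecondCountableTopology E] [BorelSpace E] (γ : Config E) :
    IsFiniteMeasureOnCompacts γ.toMeasure := by
  refine ⟨fun K hK => ?_⟩
  have hf : {y : γ.points | (y : E) ∈ K}.Finite :=
    ((γ.finite_inter K hK).subset (by rintro _ ⟨y, hy, rfl⟩; exact ⟨y.2, hy⟩)).of_finite_image
      (f := Subtype.val) Subtype.val_injective.injOn
  rw [toMeasure, Measure.sum_apply _ hK.measurableSet,
    tsum_eq_sum (s := hf.toFinset) fun y hy => ?_]
  · exact ENNReal.sum_lt_top.2 fun y _ => measure_lt_top _ _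
  · rw [Measure.dirac_apply' _ hK.measurableSet, indicator_of_notMem]
    simpa using hy

variable [T2Space E] [LocallyCompactSpace E] [SecondCountableTopology E] [BorelSpace E]

theorem measurableSpace_eq :
    borel (Config E) =
      MeasurableSpace.comap toMeasure inferInstance :=
  borel_vague

theorem measurable_toMeasure : Measurable (toMeasure : Config E → Measure E) := by
  change @Measurable _ _ (borel (Config E)) _ _
  rw [measurableSpace_eq]
  exact comap_measurable _

theorem measurable_iff {Ω : Type*} [MeasurableSpace Ω] {f : Ω → Config E} :
    Measurable f ↔ Measurable fun ω => (f ω).toMeasure := by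
  change @Measurable _ _ _ (borel (Config E)) _ ↔ _
  rw [measurableSpace_eq]
  exact measurable_comap_iff

end Config

namespace Cone

variable {X : Type*} [TopologicalSpace X] [MeasurableSpace X]

instance (η : Cone X) : IsFiniteMeasureOnCompacts η.toMeasure := ⟨η.lt_top_of_isCompact⟩

variable [T2Space X] [LocallyCompactSpace X] [SecondCountableTopology X] [BorelSpace X]

theorem measurableSpace_eq :
    borel (Cone X) =
      MeasurableSpace.comap toMeasure inferInstance :=
  borel_vague

theorem measurable_toMeasure : Measurable (toMeasure : Cone X → Measure X) := by
  change @Measurable _ _ (borel (Cone X)) _ _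
  rw [measurableSpace_eq]
  exact comap_measurable _

theorem measurable_iff {Ω : Type*} [MeasurableSpace Ω] {f : Ω → Cone X} :
    Measurable f ↔ Measurable fun ω => (f ω).toMeasure := by
  change @Measurable _ _ _ (borel (Cone X)) _ ↔ _
  rw [measurableSpace_eq]
  exact measurable_comap_iff

end Cone

/-! ### Kernels of locally finite measures -/

section Kernels

open ProbabilityTheory

/-- The total masses need not be uniformly bounded, so the parameter space is cut according to their
integer part `j`; on each piece the mass is at most `j + 1`. -/
theorem isSFiniteKernel_of_isFiniteMeasure {α β : Type*} [MeasurableSpace α] [MeasurableSpace β]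
    (κ : Kernel α β) (h : ∀ a, IsFiniteMeasure (κ a)) : IsSFiniteKernel κ := by
  classical
  have hm : Measurable fun a => ⌊(κ a univ).toReal⌋₊ :=
    (Kernel.measurable_coe κ MeasurableSet.univ).ennreal_toReal.nat_floor
  have hs : ∀ j : ℕ, MeasurableSet ((fun a => ⌊(κ a univ).toReal⌋₊) ⁻¹' {j}) := fun j =>
    hm (measurableSet_singleton j)
  have hfin : ∀ j, IsFiniteKernel (Kernel.piecewise (hs j) κ 0) := by
    refine fun j => ⟨(j : ℝ≥0∞) + 1, by finiteness, fun a => ?_⟩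
    rw [Kernel.piecewise_apply]
    split_ifs with ha
    · have ha' : ⌊(κ a univ).toReal⌋₊ = j := ha
      have h1 : (κ a univ).toReal ≤ j + 1 := by
        rw [← ha']
        exact (Nat.lt_floor_add_one _).le
      rw [← ENNReal.ofReal_toReal (measure_ne_top (κ a) univ)]
      refine (ENNReal.ofReal_le_ofReal h1).trans ?_
      rw [ENNReal.ofReal_add (by positivity) (by positivity)]
      simp
    · simp
  have hsum : κ = Kernel.sum fun j => Kernel.piecewise (hs j) κ 0 := by
    ext a s hs'
    rw [Kernel.sum_apply' _ _ hs', tsum_eq_single ⌊(κ a univ).toReal⌋₊]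
    · rw [Kernel.piecewise_apply]
      exact congrArg (fun μ : Measure β => μ s) (if_pos rfl).symm
    · intro j hj
      rw [Kernel.piecewise_apply, if_neg fun h => hj (mem_preimage.1 h).symm]
      simp
  rw [hsum]
  infer_instance

variable {E : Type*} [TopologicalSpace E] [MeasurableSpace E]

theorem iUnion_cell (E : Type*) [TopologicalSpace E] [SigmaCompactSpace E]
    [WeaklyLocallyCompactSpace E] : ⋃ n, cell E n = univ := by
  have := iUnion_disjointed (f := fun m => (CompactExhaustion.choice E m : Set E))
  rw [CompactExhaustion.iUnion_eq] at this
  exact this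

theorem pairwise_disjoint_cell (E : Type*) [TopologicalSpace E] [SigmaCompactSpace E]
    [WeaklyLocallyCompactSpace E] : Pairwise (Function.onFun Disjoint (cell E)) :=
  disjoint_disjointed _

variable [T2Space E] [LocallyCompactSpace E] [SecondCountableTopology E] [BorelSpace E]

theorem measurableSet_cell (n : ℕ) : MeasurableSet (cell E n) :=
  MeasurableSet.disjointed
    (fun m => ((CompactExhaustion.choice E).isCompact m).measurableSet) n

theorem sum_restrict_cell (μ : Measure E) : Measure.sum (fun n => μ.restrict (cell E n)) = μ := by
  rw [← Measure.restrict_iUnion (pairwise_disjoint_cell E) measurableSet_cell, iUnion_cell,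
    Measure.restrict_univ]

/-- Cutting the target into relatively compact cells reduces this to finite measures. It gives
measurability in the parameter of integrals against configurations and cone elements. -/
theorem isSFiniteKernel_of_isFiniteMeasureOnCompacts {α : Type*} [MeasurableSpace α]
    (κ : Kernel α E) (h : ∀ a, IsFiniteMeasureOnCompacts (κ a)) : IsSFiniteKernel κ := by
  have hsum : κ = Kernel.sum fun n => κ.restrict (measurableSet_cell (E := E) n) := by
    ext a : 1
    rw [Kernel.sum_apply]
    simp_rw [Kernel.restrict_apply]
    exact (sum_restrict_cell _).symm
  have : ∀ n, IsSFiniteKernel (κ.restrict (measurableSet_cell (E := E) n)) := fun n => by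
    refine isSFiniteKernel_of_isFiniteMeasure _ fun a => ?_
    rw [Kernel.restrict_apply]
    infer_instance
  rw [hsum]
  infer_instance

end Kernels

/-! ### The Mecke formula for finite Poisson processes -/

section FinitePoisson

variable {E : Type*}

/-- The tuple without its `i`-th point. -/
def eraseTuple : (z : Tuples E) → Fin z.1 → Tuples E
  | ⟨_ + 1, y⟩, i => ⟨_, i.removeNth y⟩

variable [MeasurableSpace E]

theorem measurable_sigma_of_forall_mk {ι β : Type*} {α : ι → Type*} [∀ i, MeasurableSpace (α i)]
    [MeasurableSpace β] {f : (Σ i, α i) → β} (h : ∀ i, Measurable fun a => f ⟨i, a⟩) :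
    Measurable f := by
  intro s hs
  exact MeasurableSpace.measurableSet_iInf.2 fun i => h i hs

theorem measurable_sigma_mk {ι : Type*} {α : ι → Type*} [∀ i, MeasurableSpace (α i)] (i : ι) :
    Measurable fun a : α i => (⟨i, a⟩ : Σ i, α i) := by
  intro s hs
  exact MeasurableSpace.measurableSet_iInf.1 hs i

/-- The sum of the Dirac measures at the pairs of a point of the tuple and the rest of the
tuple. -/
noncomputable def pickPoint (z : Tuples E) : Measure (E × Tuples E) :=
  ∑ i : Fin z.1, Measure.dirac (z.2 i, eraseTuple z i)

/-- The measure `∑_i δ_{z_i}`. -/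
noncomputable def tupleMeasure (z : Tuples E) : Measure E :=
  ∑ i : Fin z.1, Measure.dirac (z.2 i)

instance (z : Tuples E) : IsFiniteMeasure (pickPoint z) := by
  unfold pickPoint; infer_instance

instance (z : Tuples E) : IsFiniteMeasure (tupleMeasure z) := by
  unfold tupleMeasure; infer_instance

theorem lintegral_pickPoint (z : Tuples E) {H : E × Tuples E → ℝ≥0∞} (hH : Measurable H) :
    ∫⁻ q, H q ∂(pickPoint z) = ∑ i : Fin z.1, H (z.2 i, eraseTuple z i) := by
  rw [pickPoint, lintegral_finsetSum_measure]
  simp_rw [lintegral_dirac' _ hH]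

theorem lintegral_tupleMeasure (z : Tuples E) {H : E → ℝ≥0∞} (hH : Measurable H) :
    ∫⁻ q, H q ∂(tupleMeasure z) = ∑ i : Fin z.1, H (z.2 i) := by
  rw [tupleMeasure, lintegral_finsetSum_measure]
  simp_rw [lintegral_dirac' _ hH]

theorem tupleMeasure_eraseTuple_add : ∀ (z : Tuples E) (i : Fin z.1),
    tupleMeasure (eraseTuple z i) + Measure.dirac (z.2 i) = tupleMeasure z
  | ⟨k + 1, y⟩, i => by
    change ∑ j : Fin k, Measure.dirac (y (i.succAbove j)) + Measure.dirac (y i) =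
      ∑ j : Fin (k + 1), Measure.dirac (y j)
    rw [Fin.sum_univ_succAbove _ i, add_comm]

theorem measurable_eraseTuple_succ {k : ℕ} (i : Fin (k + 1)) :
    Measurable fun y : Fin (k + 1) → E => eraseTuple ⟨k + 1, y⟩ i :=
  (measurable_sigma_mk k).comp (measurable_pi_lambda _ fun _ => measurable_pi_apply _)

theorem measurable_pickPoint : Measurable (pickPoint : Tuples E → Measure (E × Tuples E)) := by
  refine Measure.measurable_of_measurable_coe _ fun s hs =>
    measurable_sigma_of_forall_mk fun k => ?_
  simp only [pickPoint, Measure.finsetSum_apply, Measure.dirac_apply' _ hs]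
  cases k with
  | zero => simp
  | succ k =>
    refine Finset.measurable_sum (Finset.univ : Finset (Fin (k + 1)))
      (f := fun i (y : Fin (k + 1) → E) => s.indicator 1 (y i, eraseTuple ⟨k + 1, y⟩ i))
      fun i _ => (measurable_one.indicator hs).comp ?_
    exact (measurable_pi_apply i).prodMk (measurable_eraseTuple_succ i)

theorem measurable_tupleMeasure : Measurable (tupleMeasure : Tuples E → Measure E) := by
  refine Measure.measurable_of_measurable_coe _ fun s hs =>
    measurable_sigma_of_forall_mk fun k => ?_
  simp only [tupleMeasure, Measure.finsetSum_apply, Measure.dirac_apply' _ hs]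
  exact Finset.measurable_sum (Finset.univ : Finset (Fin k))
    (f := fun i (y : Fin k → E) => s.indicator 1 (y i))
    fun i _ => (measurable_one.indicator hs).comp (measurable_pi_apply i)

theorem lintegral_tuplesLaw (ρ : Measure E) {f : Tuples E → ℝ≥0∞} (hf : Measurable f) :
    ∫⁻ z, f z ∂(tuplesLaw ρ) = ∑' k : ℕ,
      ENNReal.ofReal (Real.exp (-(ρ univ).toReal) / (k.factorial : ℝ)) *
        ∫⁻ y, f ⟨k, y⟩ ∂(Measure.pi fun _ : Fin k => ρ) := by
  rw [tuplesLaw, lintegral_sum_measure]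
  congr with k
  rw [lintegral_smul_measure, lintegral_map hf (measurable_sigma_mk k), smul_eq_mul]

/-- The Mecke formula for a finite Poisson process. -/
theorem lintegral_pickPoint_tuplesLaw (ρ : Measure E) [IsFiniteMeasure ρ]
    {H : E × Tuples E → ℝ≥0∞} (hH : Measurable H) :
    ∫⁻ z, ∫⁻ q, H q ∂(pickPoint z) ∂(tuplesLaw ρ) = ∫⁻ p, ∫⁻ z, H (p, z) ∂(tuplesLaw ρ) ∂ρ := by
  have hHk : ∀ k, Measurable fun q : E × (Fin k → E) => H (q.1, ⟨k, q.2⟩) := fun k =>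
    hH.comp (measurable_fst.prodMk ((measurable_sigma_mk k).comp measurable_snd))
  have hl : Measurable fun z => ∫⁻ q, H q ∂(pickPoint z) :=
    (Measure.measurable_lintegral hH).comp measurable_pickPoint
  rw [lintegral_tuplesLaw ρ hl]
  simp_rw [lintegral_pickPoint _ hH]
  -- The empty tuple has no point to pick; after this shift, `k + 1` points on the left are compared
  -- with `k` points on the right.
  rw [tsum_eq_zero_add' ENNReal.summable]
  have hr : ∀ p, ∫⁻ z, H (p, z) ∂(tuplesLaw ρ) = _ := fun p =>
    lintegral_tuplesLaw ρ (hH.comp (measurable_const.prodMk measurable_id))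
  simp only [Finset.univ_eq_empty, Finset.sum_empty, lintegral_zero, mul_zero, zero_add]
    at hr ⊢
  simp_rw [hr]
  rw [lintegral_tsum fun k => (((hHk k).lintegral_prod_right').const_mul _).aemeasurable]
  congr with k
  rw [lintegral_const_mul _ ((hHk k).lintegral_prod_right')]
  have hi : ∀ i : Fin (k + 1), Measurable fun y : Fin (k + 1) → E =>
      H (y i, eraseTuple ⟨k + 1, y⟩ i) := fun i =>
    hH.comp ((measurable_pi_apply i).prodMk (measurable_eraseTuple_succ i))
  rw [lintegral_finsetSum (Finset.univ : Finset (Fin (k + 1)))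
    (f := fun i y => H (y i, eraseTuple ⟨k + 1, y⟩ i)) fun i _ => hi i]
  -- Under the product measure the picked coordinate is independent of the others, so all `k + 1`
  -- choices contribute equally; the factor `k + 1` turns `1 / (k + 1)!` into `1 / k!`.
  have h1 : ∀ i : Fin (k + 1), ∫⁻ y, H (y i, eraseTuple ⟨k + 1, y⟩ i)
      ∂(Measure.pi fun _ : Fin (k + 1) => ρ) =
      ∫⁻ p, ∫⁻ y, H (p, ⟨k, y⟩) ∂(Measure.pi fun _ : Fin k => ρ) ∂ρ := by
    intro i
    rw [← lintegral_prod _ (hHk k).aemeasurable,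
      ← (measurePreserving_piFinSuccAbove (fun _ : Fin (k + 1) => ρ) i).lintegral_comp (hHk k)]
    rfl
  simp_rw [h1]
  rw [Finset.sum_const, Finset.card_univ, Fintype.card_fin, nsmul_eq_mul, ← mul_assoc]
  congr 1
  rw [← ENNReal.ofReal_natCast, ← ENNReal.ofReal_mul (by positivity)]
  congr 1
  rw [Nat.factorial_succ]
  push_cast
  field_simp

end FinitePoisson

/-! ### The Mecke formula for sequences of finite Poisson processes -/

section Sequences

open ProbabilityTheory Function

theorem Measurable.lintegral_of_isFiniteMeasure {α β : Type*} [MeasurableSpace α]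
    [MeasurableSpace β] {m : α → Measure β} (hm : Measurable m)
    (hfin : ∀ a, IsFiniteMeasure (m a)) {f : α × β → ℝ≥0∞} (hf : Measurable f) : Measurable fun a => ∫⁻ b, f (a, b) ∂(m a) := by
  let κ : Kernel α β := ⟨m, hm⟩
  have : IsSFiniteKernel κ := isSFiniteKernel_of_isFiniteMeasure κ hfin
  exact hf.lintegral_kernel_prod_right' (κ := κ)

/-- Replacing a coordinate by an independent copy preserves a product measure. -/
theorem measurePreserving_update_infinitePi {ι : Type*} [DecidableEq ι] {X : ι → Type*}
    [∀ i, MeasurableSpace (X i)] (μ : ∀ i, Measure (X i)) [∀ i, IsProbabilityMeasure (μ i)]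
    (n : ι) :
    MeasurePreserving (fun q : (∀ i, X i) × X n => update q.1 n q.2)
      ((Measure.infinitePi μ).prod (μ n)) (Measure.infinitePi μ) := by
  refine ⟨measurable_update', Measure.eq_infinitePi _ fun s t ht => ?_⟩
  have hp : (fun q : (∀ i, X i) × X n => update q.1 n q.2) ⁻¹' (Set.pi s t) =
      (Set.pi (s.erase n) t) ×ˢ (if n ∈ s then t n else univ) := by
    ext ⟨ω, z⟩
    simp only [mem_preimage, Set.mem_pi, Finset.mem_coe, mem_prod, Finset.mem_erase]
    constructor
    · intro h
      refine ⟨fun i hi => by simpa [hi.1] using h i hi.2, ?_⟩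
      split_ifs with hn
      · simpa using h n hn
      · trivial
    · rintro ⟨h1, h2⟩ i hi
      by_cases hin : i = n
      · subst hin
        simpa [hi] using h2
      · simpa [hin] using h1 i ⟨hin, hi⟩
  rw [Measure.map_apply measurable_update' (MeasurableSet.pi s.countable_toSet fun i _ => ht i), hp,
    Measure.prod_prod, Measure.infinitePi_pi _ fun i _ => ht i]
  by_cases hn : n ∈ s
  · rw [if_pos hn, Finset.prod_erase_mul _ _ hn]
  · rw [if_neg hn, measure_univ, mul_one, Finset.erase_eq_of_notMem hn]

variable {E : Type*} [MeasurableSpace E]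

theorem measurable_lintegral_pickPoint_update (n : ℕ) {H : E × (ℕ → Tuples E) → ℝ≥0∞}
    (hH : Measurable H) : Measurable fun ω : ℕ → Tuples E =>
      ∫⁻ q, H (q.1, update ω n q.2) ∂(pickPoint (ω n)) := by
  refine (measurable_pickPoint.comp (measurable_pi_apply n)).lintegral_of_isFiniteMeasure
    (fun ω => by change IsFiniteMeasure (pickPoint (ω n)); infer_instance)
    (f := fun p : (ℕ → Tuples E) × (E × Tuples E) => H (p.2.1, update p.1 n p.2.2))
    (hH.comp ((measurable_fst.comp measurable_snd).prodMk ?_))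
  exact (measurable_update' (X := fun _ : ℕ => Tuples E) (a := n)).comp
    (measurable_fst.prodMk (measurable_snd.comp measurable_snd))

/-- The Mecke formula for the points of a single process in a sequence of independent finite
Poisson processes. -/
theorem lintegral_pickPoint_infinitePi (ρ : ℕ → Measure E) [∀ n, IsFiniteMeasure (ρ n)] (n : ℕ)
    {H : E × (ℕ → Tuples E) → ℝ≥0∞} (hH : Measurable H) :
    ∫⁻ ω, ∫⁻ q, H (q.1, update ω n q.2) ∂(pickPoint (ω n))
      ∂(Measure.infinitePi fun n => tuplesLaw (ρ n)) =
    ∫⁻ ω, ∫⁻ p, H (p, ω) ∂(ρ n) ∂(Measure.infinitePi fun n => tuplesLaw (ρ n)) := by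
  have hup := measurePreserving_update_infinitePi (fun n => tuplesLaw (ρ n)) n
  have hupd : Measurable fun q : (ℕ → Tuples E) × Tuples E => update q.1 n q.2 :=
    measurable_update' (X := fun _ : ℕ => Tuples E) (a := n)
  have hG := measurable_lintegral_pickPoint_update n hH
  have hR : Measurable fun ω => ∫⁻ p, H (p, ω) ∂(ρ n) := hH.lintegral_prod_left'
  -- Resampling the `n`-th coordinate isolates it: with the other coordinates frozen, the claim is
  -- the Mecke formula for one finite process.
  rw [← hup.lintegral_comp hG, ← hup.lintegral_comp hR]
  refine (lintegral_prod _ (hG.comp hupd).aemeasurable).trans (Eq.trans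
    (lintegral_congr fun ω => ?_) (lintegral_prod _ (hR.comp hupd).aemeasurable).symm)
  simp only [Function.comp_apply, update_self, update_idem]
  have hHω : Measurable fun q : E × Tuples E => H (q.1, update ω n q.2) :=
    hH.comp (measurable_fst.prodMk (hupd.comp (measurable_const.prodMk measurable_snd)))
  rw [lintegral_pickPoint_tuplesLaw (ρ n) hHω]
  exact lintegral_lintegral_swap hHω.aemeasurable

/-- This is Mecke for the indicator of the complement of `S`: the expected number of points that
violate `S` together with the rest is an integral that vanishes by `h`. -/
theorem ae_forall_pickPoint (ρ : ℕ → Measure E) [∀ n, IsFiniteMeasure (ρ n)] (n : ℕ)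
    {S : Set (E × (ℕ → Tuples E))} (hS : MeasurableSet S)
    (h : ∀ᵐ ω ∂(Measure.infinitePi fun n => tuplesLaw (ρ n)), ∀ᵐ p ∂(ρ n), (p, ω) ∈ S) :
    ∀ᵐ ω ∂(Measure.infinitePi fun n => tuplesLaw (ρ n)), ∀ i : Fin (ω n).1,
      ((ω n).2 i, update ω n (eraseTuple (ω n) i)) ∈ S := by
  have hH : Measurable (Sᶜ.indicator (1 : E × (ℕ → Tuples E) → ℝ≥0∞)) :=
    measurable_one.indicator hS.compl
  have h1 := lintegral_pickPoint_infinitePi ρ n hH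
  rw [lintegral_congr_ae (g := 0)
    (f := fun ω => ∫⁻ p, Sᶜ.indicator (1 : E × (ℕ → Tuples E) → ℝ≥0∞) (p, ω) ∂(ρ n)),
    lintegral_zero_fun, lintegral_eq_zero_iff
    (measurable_lintegral_pickPoint_update n hH)] at h1
  · filter_upwards [h1] with ω hω i
    have hHω : Measurable fun q : E × Tuples E =>
        Sᶜ.indicator (1 : E × (ℕ → Tuples E) → ℝ≥0∞) (q.1, update ω n q.2) :=
      hH.comp (measurable_fst.prodMk ((measurable_update' (X := fun _ : ℕ => Tuples E)
        (a := n)).comp (measurable_const.prodMk measurable_snd)))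
    rw [lintegral_pickPoint _ hHω] at hω
    have := (Finset.sum_eq_zero_iff.1 hω) i (Finset.mem_univ _)
    by_contra hi
    rw [indicator_of_mem (show _ ∈ Sᶜ from hi)] at this
    exact one_ne_zero this
  · filter_upwards [h] with ω hω
    rw [lintegral_congr_ae (g := 0), lintegral_zero_fun]
    · rfl
    · filter_upwards [hω] with p hp
      exact indicator_of_notMem (show (p, ω) ∉ Sᶜ from fun h => h hp) _

theorem exists_eraseTuple_eq : ∀ (z : Tuples E) {i j : Fin z.1}, j ≠ i →
    ∃ k, (eraseTuple z i).2 k = z.2 j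
  | ⟨_ + 1, _⟩, _, _, h => by
    obtain ⟨k, rfl⟩ := Fin.exists_succAbove_eq h
    exact ⟨k, rfl⟩

/-- The points of independent finite Poisson processes have almost surely distinct images under a
map with negligible fibers. -/
theorem ae_injective_of_null_fibers {Y : Type*} [MeasurableSpace Y] [MeasurableEq Y]
    (ρ : ℕ → Measure E) [∀ n, IsFiniteMeasure (ρ n)] {f : E → Y} (hf : Measurable f)
    (h0 : ∀ n y, ρ n (f ⁻¹' {y}) = 0) :
    ∀ᵐ ω ∂(Measure.infinitePi fun n => tuplesLaw (ρ n)),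
      Injective fun a : Σ n, Fin (ω n).1 => f ((ω a.1).2 a.2) := by
  -- `D m` says that the value of `f` at the given point is not attained on the `m`-th tuple.
  -- Writing this as a vanishing integral makes its measurability immediate.
  let D : ℕ → Set (E × (ℕ → Tuples E)) := fun m =>
    {q | ∫⁻ p, {r : E × E | f r.1 = f r.2}.indicator 1 (q.1, p) ∂(tupleMeasure (q.2 m)) = 0}
  have hdiag : MeasurableSet {r : E × E | f r.1 = f r.2} :=
    measurableSet_eq_fun (hf.comp measurable_fst) (hf.comp measurable_snd)
  have hD : ∀ m, MeasurableSet (D m) := by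
    intro m
    refine (((measurable_tupleMeasure.comp (measurable_pi_apply m)).comp
      measurable_snd).lintegral_of_isFiniteMeasure
      (fun q => by change IsFiniteMeasure (tupleMeasure (q.2 m)); infer_instance)
      (f := fun a : (E × (ℕ → Tuples E)) × E =>
        {r : E × E | f r.1 = f r.2}.indicator 1 (a.1.1, a.2))
      ((measurable_one.indicator hdiag).comp
        ((measurable_fst.comp measurable_fst).prodMk measurable_snd))) (measurableSet_singleton 0)
  have hDmem : ∀ m p ω, (p, ω) ∈ D m ↔ ∀ i, f p ≠ f ((ω m).2 i) := by
    intro m p ω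
    have hm : Measurable fun r => {r : E × E | f r.1 = f r.2}.indicator (1 : E × E → ℝ≥0∞) (p, r) :=
      (measurable_one.indicator hdiag).comp (measurable_const.prodMk measurable_id)
    change ∫⁻ r, {r : E × E | f r.1 = f r.2}.indicator 1 (p, r) ∂(tupleMeasure (ω m)) = 0 ↔ _
    rw [lintegral_tupleMeasure _ hm]
    simp [Finset.sum_eq_zero_iff]
  have h1 : ∀ n m : ℕ, ∀ᵐ ω ∂(Measure.infinitePi fun n => tuplesLaw (ρ n)), ∀ i : Fin (ω n).1,
      ((ω n).2 i, update ω n (eraseTuple (ω n) i)) ∈ D m := by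
    refine fun n m => ae_forall_pickPoint ρ n (hD m) (Filter.Eventually.of_forall fun ω => ?_)
    simp_rw [hDmem]
    rw [ae_all_iff]
    exact fun i => measure_eq_zero_iff_ae_notMem.1 (h0 n (f ((ω m).2 i)))
  rw [← ae_all_iff.trans (forall_congr' fun n => ae_all_iff)] at h1
  filter_upwards [h1] with ω hω
  rintro ⟨n, i⟩ ⟨m, j⟩ hij
  by_contra hne
  have h2 := (hDmem _ _ _).1 (hω n m i)
  -- Within one tuple, the second point survives the erasure of the first; in another tuple, the
  -- erasure changes nothing. Either way it contradicts `D m`.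
  by_cases hnm : m = n
  · subst hnm
    rw [update_self] at h2
    obtain ⟨k, hk⟩ := exists_eraseTuple_eq (ω m) (i := i) (j := j) (fun h => hne (by rw [h]))
    exact h2 k (by rw [hk]; exact hij)
  · rw [update_of_ne hnm] at h2
    exact h2 j hij

/-- The measure formed by all points of a sequence of tuples. -/
noncomputable def superposition (ω : ℕ → Tuples E) : Measure E :=
  Measure.sum fun n => tupleMeasure (ω n)

theorem measurable_superposition : Measurable (superposition : (ℕ → Tuples E) → Measure E) := by
  refine Measure.measurable_of_measurable_coe _ fun s hs => ?_
  simp only [superposition, Measure.sum_apply _ hs]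
  exact Measurable.tsum fun n => (Measure.measurable_coe hs).comp
    (measurable_tupleMeasure.comp (measurable_pi_apply n))

theorem superposition_update (ω : ℕ → Tuples E) (n : ℕ) (i : Fin (ω n).1) :
    superposition (update ω n (eraseTuple (ω n) i)) + Measure.dirac ((ω n).2 i) =
      superposition ω := by
  ext s hs
  simp only [superposition, Measure.add_apply, Measure.sum_apply _ hs]
  rw [ENNReal.tsum_eq_add_tsum_ite n, ENNReal.tsum_eq_add_tsum_ite (f := fun m => tupleMeasure (ω m) s) n,
    update_self, add_right_comm, ← Measure.add_apply, tupleMeasure_eraseTuple_add]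
  congr 2 with m
  split_ifs with h
  · rfl
  · rw [update_of_ne h]

/-- For arbitrary `ω` the superposition need not be finite on compacts, so measurability comes from
its being a countable sum of finite kernels. -/
theorem measurable_integral_superposition {φ : E → ℝ} (hφ : Measurable φ) :
    Measurable fun ω => ∫ p, φ p ∂(superposition ω) := by
  let κ : ℕ → Kernel (ℕ → Tuples E) E := fun n =>
    ⟨fun ω => tupleMeasure (ω n), measurable_tupleMeasure.comp (measurable_pi_apply n)⟩
  have : ∀ n, IsSFiniteKernel (κ n) := fun n => isSFiniteKernel_of_isFiniteMeasure _ fun ω => by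
    change IsFiniteMeasure (tupleMeasure (ω n))
    infer_instance
  have h := (StronglyMeasurable.integral_kernel (κ := Kernel.sum κ) (f := φ)
    hφ.stronglyMeasurable).measurable
  simp_rw [Kernel.sum_apply] at h
  exact h

end Sequences

/-! ### The Mecke formula for the Poisson measure on the configuration space -/

section PoissonConfig

open ProbabilityTheory Function

variable {E : Type*} [TopologicalSpace E] [T2Space E] [LocallyCompactSpace E]
  [SecondCountableTopology E] [MeasurableSpace E] [BorelSpace E]

/-- The law of the sequences of tuples which define the Poisson measure with intensity `μ`. -/
noncomputable abbrev sequenceLaw (μ : Measure E) [IsFiniteMeasureOnCompacts μ] :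
    Measure (ℕ → Tuples E) :=
  Measure.infinitePi fun n : ℕ => tuplesLaw (μ.restrict (cell E n))

theorem Measurable.lintegral_of_isFiniteMeasureOnCompacts {α : Type*} [MeasurableSpace α]
    {m : α → Measure E} (hm : Measurable m) (hfin : ∀ a, IsFiniteMeasureOnCompacts (m a))
    {f : α × E → ℝ≥0∞} (hf : Measurable f) : Measurable fun a => ∫⁻ b, f (a, b) ∂(m a) := by
  let κ : Kernel α E := ⟨m, hm⟩
  have : IsSFiniteKernel κ := isSFiniteKernel_of_isFiniteMeasureOnCompacts κ hfin
  exact hf.lintegral_kernel_prod_right' (κ := κ)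

/-- A configuration forgets multiplicities and discards points outside their cells. The two
hypotheses exclude both effects, so indices correspond bijectively to points. -/
theorem toMeasure_configOfTuples {ω : ℕ → Tuples E}
    (hc : ∀ n, ∀ i : Fin (ω n).1, (ω n).2 i ∈ cell E n)
    (hi : Injective fun a : Σ n, Fin (ω n).1 => (ω a.1).2 a.2) :
    (configOfTuples ω).toMeasure = superposition ω := by
  have hr : (configOfTuples ω).points =
      range fun a : Σ n, Fin (ω n).1 => (ω a.1).2 a.2 := by
    ext y
    constructor
    · rintro ⟨n, -, i, rfl⟩
      exact ⟨⟨n, i⟩, rfl⟩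
    · rintro ⟨⟨n, i⟩, rfl⟩
      exact ⟨n, hc n i, i, rfl⟩
  let e : (Σ n, Fin (ω n).1) ≃ (configOfTuples ω).points :=
    (Equiv.ofInjective _ hi).trans (Equiv.setCongr hr.symm)
  ext s hs
  rw [Config.toMeasure, superposition, Measure.sum_apply _ hs, Measure.sum_apply _ hs,
    ← e.tsum_eq]
  refine (ENNReal.tsum_sigma fun n (i : Fin (ω n).1) => Measure.dirac ((ω n).2 i) s).trans
    (tsum_congr fun n => ?_)
  rw [tupleMeasure, Measure.finsetSum_apply, tsum_fintype]

theorem ae_mem_cell (μ : Measure E) [IsFiniteMeasureOnCompacts μ] :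
    ∀ᵐ ω ∂(sequenceLaw μ), ∀ n, ∀ i : Fin (ω n).1, (ω n).2 i ∈ cell E n := by
  rw [ae_all_iff]
  intro n
  exact ae_forall_pickPoint (fun n => μ.restrict (cell E n)) n
    (S := Prod.fst ⁻¹' cell E n) (measurable_fst (measurableSet_cell n))
    (Filter.Eventually.of_forall fun ω => ae_restrict_mem (measurableSet_cell n))

theorem ae_toMeasure_configOfTuples (μ : Measure E) [IsFiniteMeasureOnCompacts μ]
    [NullSingletonClass μ] :
    ∀ᵐ ω ∂(sequenceLaw μ), (configOfTuples ω).toMeasure = superposition ω := by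
  filter_upwards [ae_mem_cell μ, ae_injective_of_null_fibers
    (fun n => μ.restrict (cell E n)) measurable_id
    (fun n y => Measure.restrict_le_self.absolutelyContinuous (measure_singleton y))] with ω h1 h2
  exact toMeasure_configOfTuples h1 h2

instance : Inhabited (Config E) := ⟨⟨∅, by simp⟩⟩

/-- Without this the push-forward defining `poissonConfig` would be zero by convention. Off a
measurable null set the counting measure is the measurable `superposition`; on the null set the
empty configuration is substituted. -/
theorem aemeasurable_configOfTuples (μ : Measure E) [IsFiniteMeasureOnCompacts μ]
    [NullSingletonClass μ] : AEMeasurable configOfTuples (sequenceLaw μ) := by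
  classical
  obtain ⟨t, ht1, ht2, ht3⟩ := exists_measurable_superset_of_null
    (ae_toMeasure_configOfTuples μ)
  refine ⟨t.piecewise (fun _ => default) configOfTuples, ?_, ?_⟩
  · rw [Config.measurable_iff]
    have h : (fun ω => (t.piecewise (fun _ => default) configOfTuples ω).toMeasure) =
        t.piecewise (fun _ => (default : Config E).toMeasure) superposition := by
      ext ω : 1
      by_cases hω : ω ∈ t
      · simp [hω]
      · simp only [Set.piecewise, hω, if_false]
        by_contra h
        exact hω (ht1 h)
    rw [h]
    exact Measurable.piecewise ht2 measurable_const measurable_superposition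
  · filter_upwards [measure_eq_zero_iff_ae_notMem.1 ht3] with ω hω
    simp [hω]

variable (μ : Measure E) [IsFiniteMeasureOnCompacts μ] [NullSingletonClass μ]

instance : IsProbabilityMeasure (poissonConfig μ) :=
  Measure.isProbabilityMeasure_map (aemeasurable_configOfTuples μ)

theorem lintegral_poissonConfig {f : Measure E → ℝ≥0∞}
    (hf : Measurable fun γ : Config E => f γ.toMeasure) :
    ∫⁻ γ, f γ.toMeasure ∂(poissonConfig μ) = ∫⁻ ω, f (superposition ω) ∂(sequenceLaw μ) := by
  rw [poissonConfig, lintegral_map' hf.aemeasurable (aemeasurable_configOfTuples μ)]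
  refine lintegral_congr_ae ?_
  filter_upwards [ae_toMeasure_configOfTuples μ] with ω hω
  rw [hω]

theorem lintegral_superposition (ω : ℕ → Tuples E) {f : E → ℝ≥0∞} (hf : Measurable f) :
    ∫⁻ p, f p ∂(superposition ω) = ∑' n, ∑ i : Fin (ω n).1, f ((ω n).2 i) := by
  rw [superposition, lintegral_sum_measure]
  simp_rw [lintegral_tupleMeasure _ hf]

/-- The Mecke formula in terms of sequences of tuples. -/
theorem tsum_lintegral_pickPoint {H : E × (ℕ → Tuples E) → ℝ≥0∞} (hH : Measurable H) :
    ∫⁻ ω, ∑' n, ∫⁻ q, H (q.1, update ω n q.2) ∂(pickPoint (ω n)) ∂(sequenceLaw μ) =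
      ∫⁻ ω, ∫⁻ p, H (p, ω) ∂μ ∂(sequenceLaw μ) := by
  rw [lintegral_tsum fun n => (measurable_lintegral_pickPoint_update n hH).aemeasurable]
  simp_rw [lintegral_pickPoint_infinitePi (fun n => μ.restrict (cell E n)) _ hH]
  rw [← lintegral_tsum fun n => hH.lintegral_prod_left'.aemeasurable]
  refine lintegral_congr fun ω => ?_
  rw [← lintegral_sum_measure, sum_restrict_cell]

/-- The vector of the integrals `∫ φ_i dγ`. -/
noncomputable def Config.integrals {N : ℕ} (φ : Fin N → C_c(E, ℝ)) (γ : Config E) : Fin N → ℝ :=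
  fun i => ∫ p, φ i p ∂γ.toMeasure

theorem Config.measurable_integrals {N : ℕ} (φ : Fin N → C_c(E, ℝ)) :
    Measurable (Config.integrals φ) :=
  measurable_pi_lambda _ fun i =>
    measurable_integral_of_measurable Config.measurable_toMeasure (φ i)

theorem CompactlySupportedContinuousMap.measurable_vector {N : ℕ} (φ : Fin N → C_c(E, ℝ)) :
    Measurable fun p i => φ i p :=
  measurable_pi_lambda _ fun i => (φ i).continuous.measurable

/-- The reduced Mecke formula for functions of finitely many integrals. -/
theorem lintegral_mecke {N : ℕ} (φ : Fin N → C_c(E, ℝ)) {h : (Fin N → ℝ) × E → ℝ≥0∞}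
    (hh : Measurable h) :
    ∫⁻ γ, ∫⁻ p, h (γ.integrals φ - fun i => φ i p, p) ∂γ.toMeasure ∂(poissonConfig μ) =
      ∫⁻ γ, ∫⁻ p, h (γ.integrals φ, p) ∂μ ∂(poissonConfig μ) := by
  let Φ : (ℕ → Tuples E) → Fin N → ℝ := fun ω i => ∫ p, φ i p ∂(superposition ω)
  have hΦ : Measurable Φ := measurable_pi_lambda _ fun i =>
    measurable_integral_superposition (φ i).continuous.measurable
  have hφ := CompactlySupportedContinuousMap.measurable_vector φ
  have hI := Config.measurable_integrals φ
  have hL : Measurable fun γ : Config E =>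
      ∫⁻ p, h (γ.integrals φ - fun i => φ i p, p) ∂γ.toMeasure :=
    Config.measurable_toMeasure.lintegral_of_isFiniteMeasureOnCompacts inferInstance
      (f := fun q : Config E × E => h (q.1.integrals φ - fun i => φ i q.2, q.2))
      (hh.comp (((hI.comp measurable_fst).sub (hφ.comp measurable_snd)).prodMk measurable_snd))
  have hR : Measurable fun γ : Config E => ∫⁻ p, h (γ.integrals φ, p) ∂μ :=
    Measurable.lintegral_prod_right'
      (f := fun q : Config E × E => h (q.1.integrals φ, q.2))
      (hh.comp ((hI.comp measurable_fst).prodMk measurable_snd))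
  have hH : Measurable fun q : E × (ℕ → Tuples E) => h (Φ q.2, q.1) :=
    hh.comp ((hΦ.comp measurable_snd).prodMk measurable_fst)
  have e1 : ∫⁻ γ, ∫⁻ p, h (γ.integrals φ - fun i => φ i p, p) ∂γ.toMeasure ∂(poissonConfig μ) =
      ∫⁻ ω, ∫⁻ p, h (Φ ω - fun i => φ i p, p) ∂(superposition ω) ∂(sequenceLaw μ) :=
    lintegral_poissonConfig μ (f := fun m =>
      ∫⁻ p, h ((fun i => ∫ q, φ i q ∂m) - fun i => φ i p, p) ∂m) hL
  have e2 : ∫⁻ γ, ∫⁻ p, h (γ.integrals φ, p) ∂μ ∂(poissonConfig μ) =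
      ∫⁻ ω, ∫⁻ p, h (Φ ω, p) ∂μ ∂(sequenceLaw μ) :=
    lintegral_poissonConfig μ (f := fun m => ∫⁻ p, h (fun i => ∫ q, φ i q ∂m, p) ∂μ) hR
  -- Erasing a listed point lowers `Φ` by the value of `φ` there, so the integral over the
  -- superposition is the sum over picked points to which Mecke for sequences applies.
  suffices e3 : ∀ᵐ ω ∂(sequenceLaw μ),
      ∫⁻ p, h (Φ ω - fun i => φ i p, p) ∂(superposition ω) =
        ∑' n, ∫⁻ q, h (Φ (update ω n q.2), q.1) ∂(pickPoint (ω n)) by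
    rw [e1, e2, ← tsum_lintegral_pickPoint μ hH]
    exact lintegral_congr_ae e3
  filter_upwards [ae_toMeasure_configOfTuples μ] with ω hω
  -- Needed so that the `φ i` are integrable and their integrals split when a point is erased.
  have hfin : IsFiniteMeasureOnCompacts (superposition ω) := by
    rw [← hω]
    infer_instance
  have hm : Measurable fun p => h (Φ ω - fun i => φ i p, p) :=
    hh.comp ((measurable_const.sub hφ).prodMk measurable_id)
  have hupd : ∀ n, Measurable fun z : Tuples E => update ω n z := fun n =>
    (measurable_update' (X := fun _ : ℕ => Tuples E) (a := n)).comp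
      (measurable_const.prodMk measurable_id)
  have hHω : ∀ n, Measurable fun q : E × Tuples E => h (Φ (update ω n q.2), q.1) := fun n =>
    hh.comp ((hΦ.comp ((hupd n).comp measurable_snd)).prodMk measurable_fst)
  rw [lintegral_superposition ω hm]
  refine tsum_congr fun n => ?_
  rw [lintegral_pickPoint _ (hHω n)]
  refine Finset.sum_congr rfl fun k _ => ?_
  have hadd := superposition_update ω n k
  have hle : superposition (update ω n (eraseTuple (ω n) k)) ≤ superposition ω := by
    rw [← hadd]
    exact Measure.le_add_right le_rfl
  congr 2
  ext i
  have hint := (φ i).integrable_of_finite_on_compacts (superposition ω)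
  have hd : Integrable (φ i) (Measure.dirac ((ω n).2 k)) :=
    (φ i).integrable_of_finite_on_compacts _
  change (∫ p, φ i p ∂(superposition ω)) - φ i ((ω n).2 k) = ∫ p, φ i p ∂_
  rw [sub_eq_iff_eq_add, ← hadd, integral_add_measure (hint.mono_measure hle) hd,
    integral_dirac' (φ i) _ (map_continuous (φ i)).stronglyMeasurable]

/-- The points of a Poisson configuration almost surely have distinct images under a map with
negligible fibers. -/
theorem ae_injOn_configOfTuples {Y : Type*} [MeasurableSpace Y] [MeasurableEq Y] {f : E → Y}
    (hf : Measurable f) (h0 : ∀ y, μ (f ⁻¹' {y}) = 0) :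
    ∀ᵐ ω ∂(sequenceLaw μ), InjOn f (configOfTuples ω).points := by
  filter_upwards [ae_injective_of_null_fibers (fun n => μ.restrict (cell E n)) hf
    (fun n y => Measure.restrict_le_self.absolutelyContinuous (h0 y))] with ω hω
  rintro _ ⟨n, -, i, rfl⟩ _ ⟨m, -, j, rfl⟩ hij
  have := @hω ⟨n, i⟩ ⟨m, j⟩ hij
  rw [Sigma.mk.injEq] at this
  obtain ⟨rfl, h⟩ := this
  rw [eq_of_heq h]

/-- The Campbell formula. -/
theorem lintegral_campbell {f : E → ℝ≥0∞} (hf : Measurable f) :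
    ∫⁻ γ, ∫⁻ p, f p ∂γ.toMeasure ∂(poissonConfig μ) = ∫⁻ p, f p ∂μ := by
  -- With no test functions, the Mecke integrand depends on the point alone.
  have := lintegral_mecke μ (N := 0) (fun i => i.elim0) (h := fun q => f q.2)
    (hf.comp measurable_snd)
  simpa using this

end PoissonConfig

/-! ### The Poisson measure on the cone -/

theorem Config.lintegral_toMeasure {E : Type*} [TopologicalSpace E] [MeasurableSpace E]
    (γ : Config E) {f : E → ℝ≥0∞} (hf : Measurable f) :
    ∫⁻ p, f p ∂γ.toMeasure = ∑' p : γ.points, f p := by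
  rw [Config.toMeasure, lintegral_sum_measure]
  simp_rw [lintegral_dirac' _ hf]

section PairIndicator

variable {E : Type*} [TopologicalSpace E] [T2Space E] [LocallyCompactSpace E]
  [SecondCountableTopology E] [MeasurableSpace E] [BorelSpace E]

theorem Config.measurable_lintegral_indicator {D : Set (E × E)} (hD : MeasurableSet D) :
    Measurable fun a : Config E × E => ∫⁻ q, D.indicator 1 (a.2, q) ∂a.1.toMeasure := by
  have h : Measurable fun b : (Config E × E) × E =>
      D.indicator (1 : E × E → ℝ≥0∞) (b.1.2, b.2) :=
    (measurable_one.indicator hD).comp ((measurable_snd.comp measurable_fst).prodMk measurable_snd)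
  exact (Config.measurable_toMeasure.comp measurable_fst).lintegral_of_isFiniteMeasureOnCompacts
    (fun a => by change IsFiniteMeasureOnCompacts a.1.toMeasure; infer_instance) h

theorem Config.measurable_lintegral_lintegral_indicator {D : Set (E × E)} (hD : MeasurableSet D) :
    Measurable fun γ : Config E =>
      ∫⁻ p, ∫⁻ q, D.indicator 1 (p, q) ∂γ.toMeasure ∂γ.toMeasure :=
  Config.measurable_toMeasure.lintegral_of_isFiniteMeasureOnCompacts inferInstance
    (Config.measurable_lintegral_indicator hD)

theorem Config.lintegral_lintegral_indicator_eq_zero (γ : Config E) {D : Set (E × E)}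
    (hD : MeasurableSet D) :
    ∫⁻ p, ∫⁻ q, D.indicator 1 (p, q) ∂γ.toMeasure ∂γ.toMeasure = 0 ↔
      ∀ p ∈ γ.points, ∀ q ∈ γ.points, (p, q) ∉ D := by
  have h1 : Measurable fun p => ∫⁻ q, D.indicator (1 : E × E → ℝ≥0∞) (p, q) ∂γ.toMeasure :=
    (measurable_one.indicator hD).lintegral_prod_right'
  rw [γ.lintegral_toMeasure h1, ENNReal.tsum_eq_zero, Subtype.forall]
  refine forall₂_congr fun p _ => ?_
  have h2 : Measurable fun q => D.indicator (1 : E × E → ℝ≥0∞) (p, q) :=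
    (measurable_one.indicator hD).comp (measurable_const.prodMk measurable_id)
  rw [γ.lintegral_toMeasure h2, ENNReal.tsum_eq_zero, Subtype.forall]
  refine forall₂_congr fun q _ => ?_
  rw [indicator_apply_eq_zero, Pi.one_apply]
  exact imp_congr_right fun _ => iff_false_intro one_ne_zero

end PairIndicator

section ConeStructure

open ProbabilityTheory Function

variable {X : Type*} [TopologicalSpace X] [PolishSpace X] [LocallyCompactSpace X]
  [MeasurableSpace X] [BorelSpace X]

theorem measurable_weight : Measurable fun p : Marked X => ENNReal.ofReal p.1 :=
  (measurable_subtype_coe.comp measurable_fst).ennreal_ofReal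

theorem measurable_weight_mul {f : X → ℝ≥0∞} (hf : Measurable f) :
    Measurable fun p : Marked X => ENNReal.ofReal p.1 * f p.2 :=
  measurable_weight.mul (hf.comp measurable_snd)

theorem localMass_eq_lintegral (γ : Config (Marked X)) {Λ : Set X} (hΛ : MeasurableSet Λ) :
    localMass γ Λ = ∫⁻ p, ENNReal.ofReal p.1 * Λ.indicator 1 p.2 ∂γ.toMeasure := by
  rw [Config.lintegral_toMeasure, localMass]
  · congr with p
    by_cases h : p.1.2 ∈ Λ <;> simp [h]
  · exact measurable_weight_mul (measurable_one.indicator hΛ)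

theorem measurable_localMass {Λ : Set X} (hΛ : MeasurableSet Λ) :
    Measurable fun γ : Config (Marked X) => localMass γ Λ := by
  simp_rw [localMass_eq_lintegral _ hΛ]
  exact (Measure.measurable_lintegral (measurable_weight_mul
    (measurable_one.indicator hΛ))).comp Config.measurable_toMeasure

theorem localMass_mono (γ : Config (Marked X)) {Λ Λ' : Set X} (h : Λ ⊆ Λ') :
    localMass γ Λ ≤ localMass γ Λ' :=
  ENNReal.tsum_le_tsum fun _ => indicator_le_indicator_of_subset h (fun _ => zero_le) _

/-- Local mass is monotone and every relatively compact set lies in a member of the exhaustion, so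
countably many conditions suffice; this makes `pinpointing X` measurable. -/
theorem mem_pinpointing_iff (γ : Config (Marked X)) :
    γ ∈ pinpointing X ↔ InjOn Prod.snd γ.points ∧
      ∀ n, localMass γ (CompactExhaustion.choice X n) < ∞ := by
  constructor
  · rintro ⟨h1, h2⟩
    refine ⟨fun p hp q hq h => Prod.ext (h1 p hp q hq h) h, fun n => ?_⟩
    have hK := (CompactExhaustion.choice X).isCompact n
    exact h2 _ hK.measurableSet (by rwa [hK.isClosed.closure_eq])
  · rintro ⟨h1, h2⟩
    refine ⟨fun p hp q hq h => congrArg Prod.fst (h1 hp hq h), fun Λ _ hc => ?_⟩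
    obtain ⟨n, hn⟩ := (CompactExhaustion.choice X).exists_superset_of_isCompact hc
    exact (localMass_mono γ (subset_closure.trans hn)).trans_lt (h2 n)

theorem measurableSet_injOn_snd :
    MeasurableSet {γ : Config (Marked X) | InjOn Prod.snd γ.points} := by
  obtain ⟨D, hD⟩ : ∃ D : Set (Marked X × Marked X), D = {r | r.1.2 = r.2.2} \ {r | r.1 = r.2} :=
    ⟨_, rfl⟩
  have hDm : MeasurableSet D := by
    rw [hD]
    exact (measurableSet_eq_fun (measurable_snd.comp measurable_fst)
      (measurable_snd.comp measurable_snd)).diff (measurableSet_eq_fun measurable_fst measurable_snd)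
  have h : {γ : Config (Marked X) | InjOn Prod.snd γ.points} =
      (fun γ => ∫⁻ p, ∫⁻ q, D.indicator 1 (p, q) ∂γ.toMeasure ∂γ.toMeasure) ⁻¹' {0} := by
    ext γ
    rw [mem_preimage, mem_singleton_iff, γ.lintegral_lintegral_indicator_eq_zero hDm, hD]
    constructor
    · intro h p hp q hq hpq
      exact hpq.2 (h hp hq hpq.1)
    · intro h p hp q hq hpq
      by_contra hne
      exact h p hp q hq ⟨hpq, hne⟩
  rw [h]
  exact Config.measurable_lintegral_lintegral_indicator hDm (measurableSet_singleton 0)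

theorem measurableSet_pinpointing : MeasurableSet (pinpointing X) := by
  have h : pinpointing X = {γ | InjOn Prod.snd γ.points} ∩
      ⋂ n, {γ | localMass γ (CompactExhaustion.choice X n) < ∞} := by
    ext γ
    simp [mem_pinpointing_iff]
  rw [h]
  refine measurableSet_injOn_snd.inter (MeasurableSet.iInter fun n => ?_)
  exact measurableSet_lt (measurable_localMass
    ((CompactExhaustion.choice X).isCompact n).measurableSet) measurable_const

theorem measurable_coneEquiv : Measurable (coneEquiv X) := by
  refine Cone.measurable_iff.2 (Measure.measurable_of_measurable_coe _ fun Λ hΛ => ?_)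
  have : ∀ γ : pinpointing X, (coneEquiv X γ).toMeasure Λ = localMass γ.1 Λ := fun γ =>
    weightedMeasure_apply γ.1 hΛ
  simp_rw [this]
  exact (measurable_localMass hΛ).comp measurable_subtype_coe

theorem Cone.lintegral_eq (η : Cone X) {f : X → ℝ≥0∞} (hf : Measurable f) :
    ∫⁻ x, f x ∂η.toMeasure =
      ∫⁻ p, ENNReal.ofReal p.1 * f p.2 ∂(markedPoints η).toMeasure := by
  conv_lhs => rw [← weightedMeasure_markedPoints η]
  rw [Config.lintegral_toMeasure _ (measurable_weight_mul hf),
    weightedMeasure, lintegral_sum_measure]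
  simp_rw [lintegral_smul_measure, lintegral_dirac' _ hf, smul_eq_mul]

theorem Cone.toMeasure_eq_map (η : Cone X) :
    η.toMeasure = ((markedPoints η).toMeasure.withDensity
      fun p => ENNReal.ofReal p.1).map Prod.snd := by
  ext s hs
  have hm : Measurable (s.indicator (1 : X → ℝ≥0∞)) := measurable_one.indicator hs
  rw [← lintegral_indicator_one hs, ← lintegral_indicator_one hs, lintegral_map hm measurable_snd,
    η.lintegral_eq hm]
  exact (lintegral_withDensity_eq_lintegral_mul _ measurable_weight
    (hm.comp measurable_snd)).symm

theorem Cone.measurable_singleton :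
    Measurable fun a : Cone X × X => a.1.toMeasure {a.2} := by
  have hd : MeasurableSet {r : X × X | r.1 = r.2} :=
    measurableSet_eq_fun measurable_fst measurable_snd
  have h : Measurable fun a : Cone X × X =>
      ∫⁻ y, {r : X × X | r.1 = r.2}.indicator (1 : X × X → ℝ≥0∞) (y, a.2) ∂a.1.toMeasure :=
    (Cone.measurable_toMeasure.comp measurable_fst).lintegral_of_isFiniteMeasureOnCompacts
      (fun a => by change IsFiniteMeasureOnCompacts a.1.toMeasure; infer_instance)
      (f := fun b : (Cone X × X) × X =>
        {r : X × X | r.1 = r.2}.indicator (1 : X × X → ℝ≥0∞) (b.2, b.1.2))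
      ((measurable_one.indicator hd).comp
        (measurable_snd.prodMk (measurable_snd.comp measurable_fst)))
  convert h using 2 with a
  rw [← lintegral_indicator_one (measurableSet_singleton a.2)]
  refine lintegral_congr fun y => ?_
  by_cases hy : y = a.2 <;> simp [hy]

/-- The weight as a positive real number. -/
noncomputable def toPosReal (s : ℝ≥0∞) : PosReal :=
  ⟨if 0 < s.toReal then s.toReal else 1, by
    split_ifs with h
    · exact h
    · exact one_pos (α := ℝ)⟩

theorem toPosReal_ofReal (s : PosReal) : toPosReal (ENNReal.ofReal s) = s := by
  have hs : (0 : ℝ) < s := s.2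
  simp [toPosReal, ENNReal.toReal_ofReal hs.le, hs]

theorem measurable_toPosReal : Measurable toPosReal :=
  (Measurable.ite (measurableSet_lt measurable_const ENNReal.measurable_toReal)
    ENNReal.measurable_toReal measurable_const).subtype_mk

/-- A marked point counts once on the left, while `η` charges its position with its weight; dividing
by the weight compensates. The right side is visibly measurable in `η`, which yields measurability
of `markedPoints`. -/
theorem lintegral_markedPoints (η : Cone X) {f : Marked X → ℝ≥0∞} (hf : Measurable f) :
    ∫⁻ p, f p ∂(markedPoints η).toMeasure =
      ∫⁻ x, f (toPosReal (η.toMeasure {x}), x) / η.toMeasure {x} ∂η.toMeasure := by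
  have hs : Measurable fun x => η.toMeasure {x} :=
    Cone.measurable_singleton.comp (measurable_const.prodMk measurable_id)
  have hfx : Measurable fun x => f (toPosReal (η.toMeasure {x}), x) :=
    hf.comp ((measurable_toPosReal.comp hs).prodMk measurable_id)
  have hd : Measurable fun x => f (toPosReal (η.toMeasure {x}), x) / η.toMeasure {x} := hfx.div hs
  rw [η.lintegral_eq hd, Config.lintegral_toMeasure _ hf,
    Config.lintegral_toMeasure _ (measurable_weight_mul hd)]
  refine tsum_congr fun p => ?_
  have hp : η.toMeasure {p.1.2} = ENNReal.ofReal p.1.1 := p.2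
  rw [hp, toPosReal_ofReal]
  exact (ENNReal.mul_div_cancel (ENNReal.ofReal_pos.2 p.1.1.2).ne' ENNReal.ofReal_ne_top).symm

theorem measurable_markedPoints : Measurable (markedPoints : Cone X → Config (Marked X)) := by
  refine Config.measurable_iff.2 (Measure.measurable_of_measurable_coe _ fun B hB => ?_)
  have hm : Measurable (B.indicator (1 : Marked X → ℝ≥0∞)) := measurable_one.indicator hB
  simp_rw [← lintegral_indicator_one hB, lintegral_markedPoints _ hm]
  exact Cone.measurable_toMeasure.lintegral_of_isFiniteMeasureOnCompacts inferInstance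
    (f := fun a : Cone X × X =>
      B.indicator (1 : Marked X → ℝ≥0∞) (toPosReal (a.1.toMeasure {a.2}), a.2) /
        a.1.toMeasure {a.2})
    ((hm.comp ((measurable_toPosReal.comp Cone.measurable_singleton).prodMk measurable_snd)).div
      Cone.measurable_singleton)

variable (ν : Measure PosReal) [IsFiniteMeasureOnCompacts ν]
  (σ : Measure X) [IsFiniteMeasureOnCompacts σ]

theorem prod_snd_preimage [NullSingletonClass σ] (x : X) :
    (ν.prod σ) (Prod.snd ⁻¹' {x}) = 0 := by
  rw [← univ_prod, Measure.prod_prod, measure_singleton, mul_zero]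

instance [NullSingletonClass σ] : NullSingletonClass (ν.prod σ) :=
  ⟨fun p => measure_mono_null (by rintro _ rfl; rfl) (prod_snd_preimage ν σ p.2)⟩

theorem birthMeasure_eq_withDensity :
    birthMeasure ν σ = (ν.prod σ).withDensity fun p => ENNReal.ofReal p.1 :=
  prod_withDensity_left measurable_subtype_coe.ennreal_ofReal

theorem birthMeasure_lt_top (hν : ∫⁻ s : PosReal, ENNReal.ofReal s ∂ν < ∞) {K : Set X}
    (hK : IsCompact K) : birthMeasure ν σ (Prod.snd ⁻¹' K) < ∞ := by
  rw [birthMeasure, ← univ_prod, Measure.prod_prod, withDensity_apply _ MeasurableSet.univ,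
    Measure.restrict_univ]
  exact ENNReal.mul_lt_top hν hK.measure_lt_top

variable [NullSingletonClass σ]

/-- Positions are distinct because σ has no atoms, so fibers of the projection to `X` are null. By
Campbell, the local mass of a compact `K` has expectation `(∫ s dν) σ(K) < ∞`. -/
theorem ae_mem_pinpointing (hν : ∫⁻ s : PosReal, ENNReal.ofReal s ∂ν < ∞) :
    ∀ᵐ γ ∂(poissonConfig (ν.prod σ)), γ ∈ pinpointing X := by
  have h1 : ∀ᵐ γ ∂(poissonConfig (ν.prod σ)), InjOn Prod.snd γ.points :=
    (ae_map_iff (aemeasurable_configOfTuples (ν.prod σ)) measurableSet_injOn_snd).2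
      (ae_injOn_configOfTuples (ν.prod σ) measurable_snd (prod_snd_preimage ν σ))
  have h2 : ∀ n, ∀ᵐ γ ∂(poissonConfig (ν.prod σ)),
      localMass γ (CompactExhaustion.choice X n) < ∞ := by
    intro n
    have hK := (CompactExhaustion.choice X).isCompact n
    refine ae_lt_top (measurable_localMass hK.measurableSet) (ne_of_lt ?_)
    simp_rw [localMass_eq_lintegral _ hK.measurableSet]
    have hm : Measurable fun p : Marked X =>
        ((CompactExhaustion.choice X n : Set X).indicator (1 : X → ℝ≥0∞)) p.2 :=
      (measurable_one.indicator hK.measurableSet).comp measurable_snd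
    rw [lintegral_campbell (ν.prod σ)
      (measurable_weight_mul (measurable_one.indicator hK.measurableSet))]
    have h3 := lintegral_withDensity_eq_lintegral_mul (ν.prod σ) measurable_weight hm
    rw [← birthMeasure_eq_withDensity] at h3
    refine lt_of_eq_of_lt (h3.symm.trans ?_) (birthMeasure_lt_top ν σ hν hK)
    rw [← lintegral_indicator_one (measurable_snd hK.measurableSet)]
    rfl
  filter_upwards [h1, ae_all_iff.2 h2] with γ h3 h4
  exact (mem_pinpointing_iff γ).2 ⟨h3, h4⟩

/-- Since `pinpointing X` has full measure, restricting to it loses nothing. Statements about π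
thereby become statements about the Poisson measure. -/
theorem measurePreserving_markedPoints (hν : ∫⁻ s : PosReal, ENNReal.ofReal s ∂ν < ∞) :
    MeasurePreserving markedPoints (poissonCone ν σ) (poissonConfig (ν.prod σ)) := by
  refine ⟨measurable_markedPoints, ?_⟩
  rw [poissonCone, Measure.map_map measurable_markedPoints measurable_coneEquiv]
  have h : markedPoints ∘ coneEquiv X = (Subtype.val : pinpointing X → Config (Marked X)) := by
    ext1 γ
    exact congrArg Subtype.val ((coneEquiv X).symm_apply_apply γ)
  rw [h, (MeasurableEmbedding.subtype_coe measurableSet_pinpointing).map_comap,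
    Subtype.range_coe]
  exact Measure.restrict_eq_self_of_ae_mem (ae_mem_pinpointing ν σ hν)

theorem isProbabilityMeasure_poissonCone (hν : ∫⁻ s : PosReal, ENNReal.ofReal s ∂ν < ∞) :
    IsProbabilityMeasure (poissonCone ν σ) := by
  have h := measurePreserving_markedPoints ν σ hν
  refine ⟨?_⟩
  rw [← preimage_univ (f := markedPoints), ← Measure.map_apply h.measurable MeasurableSet.univ,
    h.map_eq, measure_univ]

end ConeStructure

/-! ### The Mecke formula for real-valued functions -/

section SignedMecke

open ProbabilityTheory

variable {E : Type*} [TopologicalSpace E] [T2Space E] [LocallyCompactSpace E]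
  [SecondCountableTopology E] [MeasurableSpace E] [BorelSpace E]

/-- The kernel which maps a configuration to its counting measure. -/
noncomputable def configKernel (E : Type*) [TopologicalSpace E] [T2Space E] [LocallyCompactSpace E]
    [SecondCountableTopology E] [MeasurableSpace E] [BorelSpace E] : Kernel (Config E) E :=
  ⟨Config.toMeasure, Config.measurable_toMeasure⟩

theorem configKernel_apply (γ : Config E) : configKernel E γ = γ.toMeasure := rfl

instance : IsSFiniteKernel (configKernel E) :=
  isSFiniteKernel_of_isFiniteMeasureOnCompacts _ fun γ => by
    rw [configKernel_apply]
    infer_instance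

variable (μ : Measure E) [IsFiniteMeasureOnCompacts μ] [NullSingletonClass μ]

/-- Mecke as an equality of measures, with the Campbell measure on the left; integrability and
signed integrals then transfer by change of variables. -/
theorem map_compProd_configKernel {N : ℕ} (φ : Fin N → C_c(E, ℝ)) :
    ((poissonConfig μ).compProd (configKernel E)).map
        (fun q => (q.1.integrals φ - fun i => φ i q.2, q.2)) =
      ((poissonConfig μ).prod μ).map fun q => (q.1.integrals φ, q.2) := by
  have hφ := CompactlySupportedContinuousMap.measurable_vector φ
  have hI := Config.measurable_integrals φ
  have hT : Measurable fun q : Config E × E => (q.1.integrals φ - fun i => φ i q.2, q.2) :=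
    ((hI.comp measurable_fst).sub (hφ.comp measurable_snd)).prodMk measurable_snd
  have hT' : Measurable fun q : Config E × E => (q.1.integrals φ, q.2) :=
    (hI.comp measurable_fst).prodMk measurable_snd
  ext s hs
  have hm : Measurable (s.indicator (1 : (Fin N → ℝ) × E → ℝ≥0∞)) := measurable_one.indicator hs
  rw [← lintegral_indicator_one hs, ← lintegral_indicator_one hs, lintegral_map hm hT,
    lintegral_map hm hT']
  exact (Measure.lintegral_compProd (hm.comp hT)).trans ((lintegral_mecke μ φ hm).trans
    (lintegral_prod _ (hm.comp hT').aemeasurable).symm)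

theorem integral_mecke {N : ℕ} (φ : Fin N → C_c(E, ℝ)) {h : (Fin N → ℝ) × E → ℝ}
    (hh : Measurable h)
    (hint : Integrable (fun q : Config E × E => h (q.1.integrals φ, q.2))
      ((poissonConfig μ).prod μ)) :
    Integrable (fun γ => ∫ p, h (γ.integrals φ - fun i => φ i p, p) ∂γ.toMeasure)
        (poissonConfig μ) ∧
      Integrable (fun γ => ∫ p, h (γ.integrals φ, p) ∂μ) (poissonConfig μ) ∧
      ∫ γ, ∫ p, h (γ.integrals φ - fun i => φ i p, p) ∂γ.toMeasure ∂(poissonConfig μ) =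
        ∫ γ, ∫ p, h (γ.integrals φ, p) ∂μ ∂(poissonConfig μ) := by
  have hφ := CompactlySupportedContinuousMap.measurable_vector φ
  have hI := Config.measurable_integrals φ
  have hT : Measurable fun q : Config E × E => (q.1.integrals φ - fun i => φ i q.2, q.2) :=
    ((hI.comp measurable_fst).sub (hφ.comp measurable_snd)).prodMk measurable_snd
  have hT' : Measurable fun q : Config E × E => (q.1.integrals φ, q.2) :=
    (hI.comp measurable_fst).prodMk measurable_snd
  have h1 : Integrable h (((poissonConfig μ).prod μ).map fun q => (q.1.integrals φ, q.2)) :=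
    (integrable_map_measure hh.aestronglyMeasurable hT'.aemeasurable).2 hint
  have h2 : Integrable (fun q : Config E × E => h (q.1.integrals φ - fun i => φ i q.2, q.2))
      ((poissonConfig μ).compProd (configKernel E)) := by
    rw [← map_compProd_configKernel] at h1
    exact (integrable_map_measure hh.aestronglyMeasurable hT.aemeasurable).1 h1
  refine ⟨MeasureTheory.Integrable.integral_compProd
    (κ := Kernel.const Unit (poissonConfig μ)) (η := Kernel.prodMkLeft Unit (configKernel E))
    (a := ()) h2, hint.integral_prod_left, ?_⟩
  have h3 := integral_map hT.aemeasurable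
    (μ := (poissonConfig μ).compProd (configKernel E)) (f := h) hh.aestronglyMeasurable
  have h4 := integral_map hT'.aemeasurable
    (μ := (poissonConfig μ).prod μ) (f := h) hh.aestronglyMeasurable
  rw [map_compProd_configKernel, h4, Measure.integral_compProd h2, integral_prod _ hint] at h3
  exact h3.symm

end SignedMecke

/-! ### Adding and removing points -/

section Points

variable {E : Type*} [TopologicalSpace E] [T2Space E] [LocallyCompactSpace E]
  [SecondCountableTopology E] [MeasurableSpace E] [BorelSpace E]

theorem Config.ae_mem_points (γ : Config E) : ∀ᵐ p ∂γ.toMeasure, p ∈ γ.points := by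
  have hc : Countable γ.points := γ.countable
  rw [Config.toMeasure, Measure.ae_sum_iff]
  intro p
  exact (ae_dirac_iff γ.countable.measurableSet).2 p.2

theorem Config.toMeasure_insert {γ γ' : Config E} {p : E} (hp : p ∉ γ.points)
    (h : γ'.points = insert p γ.points) : γ'.toMeasure = γ.toMeasure + Measure.dirac p := by
  ext s hs
  rw [Measure.add_apply, Config.toMeasure, Config.toMeasure, Measure.sum_apply _ hs,
    Measure.sum_apply _ hs, h, insert_eq, union_comm,
    ENNReal.summable.tsum_union_disjoint (f := fun y => Measure.dirac y s)
      (disjoint_singleton_right.2 hp) ENNReal.summable,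
    tsum_singleton p fun y => Measure.dirac y s]

theorem Config.integrals_insert {N : ℕ} (φ : Fin N → C_c(E, ℝ)) {γ γ' : Config E} {p : E}
    (hp : p ∉ γ.points) (h : γ'.points = insert p γ.points) :
    γ'.integrals φ = γ.integrals φ + fun i => φ i p := by
  ext i
  rw [Pi.add_apply, Config.integrals, Config.integrals, Config.toMeasure_insert hp h,
    integral_add_measure ((φ i).integrable_of_finite_on_compacts _)
      ((φ i).integrable_of_finite_on_compacts _),
    integral_dirac' (φ i) _ (map_continuous (φ i)).stronglyMeasurable]

end Points

/-! ### Gradients of cylinder functions -/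

section Gradients

variable {X : Type*} [TopologicalSpace X] [PolishSpace X] [LocallyCompactSpace X]
  [MeasurableSpace X] [BorelSpace X]

theorem mem_markedPoints {η : Cone X} {p : Marked X} :
    p ∈ (markedPoints η).points ↔ η.toMeasure {p.2} = ENNReal.ofReal p.1 := Iff.rfl

theorem eq_of_ofReal_eq {p q : Marked X} (h1 : ENNReal.ofReal p.1 = ENNReal.ofReal q.1)
    (h2 : p.2 = q.2) : p = q :=
  Prod.ext (Subtype.ext ((ENNReal.ofReal_eq_ofReal_iff (le_of_lt p.1.2) (le_of_lt q.1.2)).1 h1)) h2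

/-- Phrased as an insertion so that `Config.integrals_insert` serves removal and addition alike. -/
theorem markedPoints_remove {η : Cone X} {p : Marked X} (hp : p ∈ (markedPoints η).points) :
    p ∉ (markedPoints (η.remove p.2)).points ∧
      (markedPoints η).points = insert p (markedPoints (η.remove p.2)).points := by
  have h1 : (η.remove p.2).toMeasure {p.2} = 0 := by
    change η.toMeasure.restrict {p.2}ᶜ {p.2} = 0
    rw [Measure.restrict_apply (measurableSet_singleton _), inter_compl_self, measure_empty]
  have h2 : ∀ x ≠ p.2, (η.remove p.2).toMeasure {x} = η.toMeasure {x} := by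
    intro x hx
    change η.toMeasure.restrict {p.2}ᶜ {x} = _
    rw [Measure.restrict_apply (measurableSet_singleton _), inter_eq_left.2]
    simpa using hx.symm
  have h3 : ∀ q ∈ (markedPoints (η.remove p.2)).points, q.2 ≠ p.2 := by
    intro q hq h
    rw [mem_markedPoints, h, h1] at hq
    exact (ENNReal.ofReal_pos.2 q.1.2).ne hq
  refine ⟨fun h => h3 p h rfl, ?_⟩
  ext q
  rw [mem_insert_iff]
  constructor
  · intro hq
    by_cases h : q.2 = p.2
    · left
      refine eq_of_ofReal_eq ?_ h
      rw [← mem_markedPoints.1 hq, ← mem_markedPoints.1 hp, h]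
    · right
      rw [mem_markedPoints, h2 _ h]
      exact hq
  · rintro (rfl | hq)
    · exact hp
    · rw [mem_markedPoints, ← h2 _ (h3 q hq)]
      exact hq

theorem markedPoints_add {η : Cone X} {p : Marked X} (hp : p.2 ∉ η.supp) :
    p ∉ (markedPoints η).points ∧
      (markedPoints (η.add p)).points = insert p (markedPoints η).points := by
  have h0 : η.toMeasure {p.2} = 0 := by
    by_contra h
    exact hp (pos_iff_ne_zero.2 h)
  have h1 : (η.add p).toMeasure {p.2} = ENNReal.ofReal p.1 := by
    change (η.toMeasure + ENNReal.ofReal p.1 • Measure.dirac p.2) {p.2} = _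
    simp [h0]
  have h2 : ∀ x ≠ p.2, (η.add p).toMeasure {x} = η.toMeasure {x} := by
    intro x hx
    change (η.toMeasure + ENNReal.ofReal p.1 • Measure.dirac p.2) {x} = _
    simp [hx.symm]
  have h3 : ∀ q ∈ (markedPoints η).points, q.2 ≠ p.2 := by
    intro q hq h
    rw [mem_markedPoints, h, h0] at hq
    exact (ENNReal.ofReal_pos.2 q.1.2).ne hq
  refine ⟨fun h => h3 p h rfl, ?_⟩
  ext q
  rw [mem_insert_iff]
  constructor
  · intro hq
    by_cases h : q.2 = p.2
    · left
      refine eq_of_ofReal_eq ?_ h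
      rw [← mem_markedPoints.1 hq, h, h1]
    · right
      rw [mem_markedPoints, ← h2 _ h]
      exact hq
  · rintro (rfl | hq)
    · exact h1
    · rw [mem_markedPoints, h2 _ (h3 q hq)]
      exact hq

theorem mem_cylinderFunctions_iff {F : Cone X → ℝ} :
    F ∈ cylinderFunctions X ↔ ∃ (N : ℕ) (_ : 1 ≤ N) (g : (Fin N → ℝ) →ᵇ ℝ)
      (φ : Fin N → C_c(Marked X, ℝ)), ∀ η, F η = g ((markedPoints η).integrals φ) := Iff.rfl

theorem exists_common_representation {F G : Cone X → ℝ} (hF : F ∈ cylinderFunctions X)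
    (hG : G ∈ cylinderFunctions X) :
    ∃ (N : ℕ) (φ : Fin N → C_c(Marked X, ℝ)) (g g' : (Fin N → ℝ) →ᵇ ℝ),
      (∀ η, F η = g ((markedPoints η).integrals φ)) ∧
      ∀ η, G η = g' ((markedPoints η).integrals φ) := by
  obtain ⟨N, -, g, φ, hF⟩ := hF
  obtain ⟨M, -, g', φ', hG⟩ := hG
  refine ⟨N + M, Fin.append φ φ', g.compContinuous ⟨fun v i => v (Fin.castAdd M i), by fun_prop⟩,
    g'.compContinuous ⟨fun v i => v (Fin.natAdd N i), by fun_prop⟩, fun η => ?_, fun η => ?_⟩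
  · rw [hF]
    simp [Config.integrals, pairing, coneEquiv]
  · rw [hG]
    simp [Config.integrals, pairing, coneEquiv]

variable {N : ℕ} {φ : Fin N → C_c(Marked X, ℝ)} {F G : Cone X → ℝ} {g g' : (Fin N → ℝ) →ᵇ ℝ}

theorem deathGradient_eq (hF : ∀ η, F η = g ((markedPoints η).integrals φ)) {η : Cone X}
    {p : Marked X} (hp : p ∈ (markedPoints η).points) :
    deathGradient F η p.2 = g ((markedPoints η).integrals φ - fun i => φ i p) -
      g ((markedPoints η).integrals φ) := by
  obtain ⟨h1, h2⟩ := markedPoints_remove hp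
  rw [deathGradient, hF, hF, Config.integrals_insert φ h1 h2, add_sub_cancel_right]

theorem birthGradient_eq (hF : ∀ η, F η = g ((markedPoints η).integrals φ)) {η : Cone X}
    {p : Marked X} (hp : p.2 ∉ η.supp) :
    birthGradient F η p = g ((markedPoints η).integrals φ + fun i => φ i p) -
      g ((markedPoints η).integrals φ) := by
  obtain ⟨h1, h2⟩ := markedPoints_add hp
  rw [birthGradient, hF, hF, Config.integrals_insert φ h1 h2]

/-- Both gradients vanish over positions outside `K`; compactness in the `X`-direction alone
suffices, since `η` and, over all weights, `birthMeasure` are finite there. -/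
theorem exists_isCompact_of_vector (φ : Fin N → C_c(Marked X, ℝ)) :
    ∃ K : Set X, IsCompact K ∧ ∀ p : Marked X, p.2 ∉ K → (fun i => φ i p) = 0 := by
  refine ⟨⋃ i, Prod.snd '' tsupport (φ i), isCompact_iUnion fun i =>
    (φ i).hasCompactSupport.isCompact.image continuous_snd, fun p hp => ?_⟩
  ext i
  refine image_eq_zero_of_notMem_tsupport fun h => hp (mem_iUnion.2 ⟨i, p, h, rfl⟩)

theorem BoundedContinuousFunction.abs_sub_le (g : (Fin N → ℝ) →ᵇ ℝ) (v w : Fin N → ℝ) :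
    |g v - g w| ≤ 2 * ‖g‖ := by
  rw [← Real.dist_eq]
  exact g.dist_le_two_norm v w

/-- A function set to zero off a countable set has only countable or co-countable preimages. This
spares any measurability study of `x ↦ F (η.remove x)`. -/
theorem aestronglyMeasurable_of_countable {α : Type*} [MeasurableSpace α]
    [MeasurableSingletonClass α] {μ : Measure α} {S : Set α} (hS : S.Countable) (h0 : μ Sᶜ = 0)
    (f : α → ℝ) : AEStronglyMeasurable f μ := by
  refine ⟨S.indicator f, Measurable.stronglyMeasurable fun t _ => ?_, ?_⟩
  · rw [indicator_preimage, Set.ite]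
    refine (hS.mono inter_subset_right).measurableSet.union (MeasurableSet.diff ?_ hS.measurableSet)
    by_cases h : (0 : ℝ) ∈ t
    · convert MeasurableSet.univ
      ext
      simp [h]
    · convert MeasurableSet.empty
      ext
      simp [h]
  · filter_upwards [measure_eq_zero_iff_ae_notMem.1 h0] with x hx
    rw [indicator_of_mem (not_not.1 hx)]

theorem Cone.aestronglyMeasurable (η : Cone X) (f : X → ℝ) :
    AEStronglyMeasurable f η.toMeasure :=
  aestronglyMeasurable_of_countable η.countable_supp η.compl_supp f

theorem Cone.ae_exists_mem_markedPoints (η : Cone X) :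
    ∀ᵐ x ∂η.toMeasure, ∃ p ∈ (markedPoints η).points, p.2 = x := by
  filter_upwards [measure_eq_zero_iff_ae_notMem.1 η.compl_supp] with x hx
  have hx' : 0 < η.toMeasure {x} := not_not.1 hx
  refine ⟨(⟨(η.toMeasure {x}).toReal, ENNReal.toReal_pos hx'.ne' (η.singleton_lt_top x).ne⟩, x),
    ?_, rfl⟩
  exact (ENNReal.ofReal_toReal (η.singleton_lt_top x).ne).symm

theorem memLp_deathGradient (hF : F ∈ cylinderFunctions X) (η : Cone X) :
    MemLp (deathGradient F η) 2 η.toMeasure := by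
  obtain ⟨N, -, g, φ, hF⟩ := mem_cylinderFunctions_iff.1 hF
  obtain ⟨K, hK, hKφ⟩ := exists_isCompact_of_vector φ
  refine MemLp.mono (memLp_indicator_const 2 hK.measurableSet (2 * ‖g‖)
    (Or.inr (η.lt_top_of_isCompact K hK).ne)) (η.aestronglyMeasurable _) ?_
  filter_upwards [η.ae_exists_mem_markedPoints] with x hx
  obtain ⟨p, hp, rfl⟩ := hx
  rw [deathGradient_eq hF hp]
  by_cases h : p.2 ∈ K
  · rw [indicator_of_mem h, Real.norm_eq_abs, Real.norm_of_nonneg (by positivity)]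
    exact g.abs_sub_le _ _
  · simp [hKφ p h]

variable (ν : Measure PosReal) [IsFiniteMeasureOnCompacts ν]
  (σ : Measure X) [IsFiniteMeasureOnCompacts σ] [NullSingletonClass σ]

theorem ae_notMem_supp (η : Cone X) : ∀ᵐ p ∂(ν.prod σ), p.2 ∉ η.supp := by
  have h : (ν.prod σ) (Prod.snd ⁻¹' η.supp) = 0 := ?_
  · exact measure_eq_zero_iff_ae_notMem.1 h
  rw [← univ_prod, Measure.prod_prod, η.countable_supp.measure_zero, mul_zero]

theorem ae_birthMeasure_notMem_supp (η : Cone X) :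
    ∀ᵐ p ∂(birthMeasure ν σ), p.2 ∉ η.supp := by
  rw [birthMeasure_eq_withDensity]
  exact (withDensity_absolutelyContinuous _ _).ae_le (ae_notMem_supp ν σ η)

theorem memLp_birthGradient (hν : ∫⁻ s : PosReal, ENNReal.ofReal s ∂ν < ∞)
    (hF : F ∈ cylinderFunctions X) (η : Cone X) :
    MemLp (birthGradient F η) 2 (birthMeasure ν σ) := by
  obtain ⟨N, -, g, φ, hF⟩ := mem_cylinderFunctions_iff.1 hF
  obtain ⟨K, hK, hKφ⟩ := exists_isCompact_of_vector φ
  have hae : (fun p => g ((markedPoints η).integrals φ + fun i => φ i p) -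
      g ((markedPoints η).integrals φ)) =ᵐ[birthMeasure ν σ] birthGradient F η := by
    filter_upwards [ae_birthMeasure_notMem_supp ν σ η] with p hp
    rw [birthGradient_eq hF hp]
  refine MemLp.ae_eq hae ?_
  refine MemLp.mono (memLp_indicator_const 2 (measurable_snd hK.measurableSet) (2 * ‖g‖)
    (Or.inr (birthMeasure_lt_top ν σ hν hK).ne)) ?_ (Filter.Eventually.of_forall fun p => ?_)
  · exact ((g.continuous.measurable.comp (measurable_const.add
      (CompactlySupportedContinuousMap.measurable_vector φ))).sub_const _).aestronglyMeasurable
  · by_cases h : p.2 ∈ K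
    · rw [indicator_of_mem (show p ∈ Prod.snd ⁻¹' K from h), Real.norm_eq_abs,
        Real.norm_of_nonneg (by positivity)]
      exact g.abs_sub_le _ _
    · simp [hKφ p h]

/-! ### The equality of the two Dirichlet integrals -/

/-- The product of the increments of `g` and `g'` at `v` in the direction `φ(p)`, weighted with
the first component of `p = (s, x)`. -/
noncomputable def incrementProduct (φ : Fin N → C_c(Marked X, ℝ)) (g g' : (Fin N → ℝ) →ᵇ ℝ)
    (q : (Fin N → ℝ) × Marked X) : ℝ :=
  q.2.1 * ((g (q.1 + fun i => φ i q.2) - g q.1) * (g' (q.1 + fun i => φ i q.2) - g' q.1))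

theorem measurable_incrementProduct (φ : Fin N → C_c(Marked X, ℝ)) (g g' : (Fin N → ℝ) →ᵇ ℝ) :
    Measurable (incrementProduct φ g g') := by
  have hadd : Measurable fun q : (Fin N → ℝ) × Marked X => q.1 + fun i => φ i q.2 :=
    measurable_fst.add ((CompactlySupportedContinuousMap.measurable_vector φ).comp measurable_snd)
  have hd : ∀ f : (Fin N → ℝ) →ᵇ ℝ, Measurable fun q : (Fin N → ℝ) × Marked X =>
      f (q.1 + fun i => φ i q.2) - f q.1 := fun f =>
    (f.continuous.measurable.comp hadd).sub (f.continuous.measurable.comp measurable_fst)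
  exact (measurable_subtype_coe.comp (measurable_fst.comp measurable_snd)).mul ((hd g).mul (hd g'))

/-- Integration against `η` weights each marked point by `s`, the first factor of
`incrementProduct`. The death gradient is minus the increment from the vector with `p` removed; the
two signs cancel in the product. -/
theorem deathInner_eq (hF : ∀ η, F η = g ((markedPoints η).integrals φ))
    (hG : ∀ η, G η = g' ((markedPoints η).integrals φ)) (η : Cone X) :
    deathInner F G η = ∫ p, incrementProduct φ g g'
      ((markedPoints η).integrals φ - fun i => φ i p, p) ∂(markedPoints η).toMeasure := by
  have hm := η.aestronglyMeasurable fun x => deathGradient F η x * deathGradient G η x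
  rw [deathInner]
  rw [η.toMeasure_eq_map] at hm ⊢
  rw [integral_map measurable_snd.aemeasurable hm, integral_withDensity_eq_integral_toReal_smul
    measurable_weight (Filter.Eventually.of_forall fun _ => ENNReal.ofReal_lt_top)]
  refine integral_congr_ae ?_
  filter_upwards [(markedPoints η).ae_mem_points] with p hp
  have hp0 : (0 : ℝ) < p.1 := p.1.2
  rw [deathGradient_eq hF hp, deathGradient_eq hG hp, ENNReal.toReal_ofReal hp0.le, smul_eq_mul,
    incrementProduct]
  simp only [sub_add_cancel]
  ring

theorem birthInner_eq (hF : ∀ η, F η = g ((markedPoints η).integrals φ))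
    (hG : ∀ η, G η = g' ((markedPoints η).integrals φ)) (η : Cone X) :
    birthInner ν σ F G η = ∫ p, incrementProduct φ g g'
      ((markedPoints η).integrals φ, p) ∂(ν.prod σ) := by
  rw [birthInner, birthMeasure_eq_withDensity, integral_withDensity_eq_integral_toReal_smul
    measurable_weight (Filter.Eventually.of_forall fun _ => ENNReal.ofReal_lt_top)]
  refine integral_congr_ae ?_
  filter_upwards [ae_notMem_supp ν σ η] with p hp
  have hp0 : (0 : ℝ) < p.1 := p.1.2
  rw [birthGradient_eq hF hp, birthGradient_eq hG hp, ENNReal.toReal_ofReal hp0.le, smul_eq_mul,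
    incrementProduct]

/-- The product is at most `4 s ‖g‖ ‖g'‖` over `K` and zero elsewhere, and the first moment of ν
makes this bound integrable. -/
theorem integrable_incrementProduct
    (hν : ∫⁻ s : PosReal, ENNReal.ofReal s ∂ν < ∞)
    (φ : Fin N → C_c(Marked X, ℝ)) (g g' : (Fin N → ℝ) →ᵇ ℝ) :
    Integrable (fun q : Config (Marked X) × Marked X =>
      incrementProduct φ g g' (q.1.integrals φ, q.2))
      ((poissonConfig (ν.prod σ)).prod (ν.prod σ)) := by
  obtain ⟨K, hK, hKφ⟩ := exists_isCompact_of_vector φ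
  have hw : Measurable fun p : Marked X => (p.1 : ℝ) := measurable_subtype_coe.comp measurable_fst
  have hb : Integrable (fun p : Marked X =>
      (Prod.snd ⁻¹' K).indicator (fun p : Marked X => (p.1 : ℝ) * (2 * ‖g‖ * (2 * ‖g'‖))) p)
      (ν.prod σ) := by
    rw [integrable_indicator_iff (measurable_snd hK.measurableSet)]
    refine Integrable.mul_const ⟨hw.aestronglyMeasurable, ?_⟩ _
    have h := birthMeasure_lt_top ν σ hν hK
    rw [birthMeasure_eq_withDensity, withDensity_apply _ (measurable_snd hK.measurableSet)] at h
    refine lt_of_eq_of_lt (lintegral_congr fun p => ?_) h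
    rw [Real.enorm_of_nonneg (le_of_lt p.1.2)]
  refine (hb.comp_snd (poissonConfig (ν.prod σ))).mono' ?_ (Filter.Eventually.of_forall fun q => ?_)
  · exact ((measurable_incrementProduct φ g g').comp (((Config.measurable_integrals φ).comp
      measurable_fst).prodMk measurable_snd)).aestronglyMeasurable
  · by_cases h : q.2.2 ∈ K
    · rw [indicator_of_mem (show q.2 ∈ Prod.snd ⁻¹' K from h), incrementProduct, Real.norm_eq_abs,
        abs_mul, abs_mul, abs_of_pos (show (0 : ℝ) < q.2.1 from q.2.1.2)]
      have h0 : (0 : ℝ) ≤ q.2.1 := le_of_lt q.2.1.2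
      gcongr
      · exact g.abs_sub_le _ _
      · exact g'.abs_sub_le _ _
    · rw [indicator_of_notMem (show q.2 ∉ Prod.snd ⁻¹' K from h), incrementProduct]
      simp [hKφ q.2 h]

end Gradients

/-! ### The Dirichlet form on cylinder functions and on their classes -/

section DirichletForm

variable {X : Type*} [TopologicalSpace X] [PolishSpace X] [LocallyCompactSpace X]
  [MeasurableSpace X] [BorelSpace X] {F G H : Cone X → ℝ}

theorem deathInner_comm (F G : Cone X → ℝ) : deathInner F G = deathInner G F := by
  ext η
  simp_rw [deathInner, mul_comm]

theorem deathInner_add (hF : F ∈ cylinderFunctions X) (hG : G ∈ cylinderFunctions X)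
    (hH : H ∈ cylinderFunctions X) :
    deathInner (F + G) H = deathInner F H + deathInner G H := by
  ext η
  have h1 := (memLp_deathGradient hF η).integrable_mul (memLp_deathGradient hH η)
  have h2 := (memLp_deathGradient hG η).integrable_mul (memLp_deathGradient hH η)
  refine Eq.trans (integral_congr_ae (Filter.Eventually.of_forall fun x => ?_)) (integral_add h1 h2)
  simp only [deathGradient, Pi.add_apply]
  ring

theorem deathInner_smul (c : ℝ) (F G : Cone X → ℝ) :
    deathInner (c • F) G = c • deathInner F G := by
  ext η
  rw [Pi.smul_apply, deathInner, deathInner, smul_eq_mul, ← integral_const_mul]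
  congr with x
  simp only [deathGradient, Pi.smul_apply, smul_eq_mul]
  ring

variable (ν : Measure PosReal) [IsFiniteMeasureOnCompacts ν]
  (σ : Measure X) [IsFiniteMeasureOnCompacts σ]

theorem dirichletForm_comm (F G : Cone X → ℝ) : dirichletForm ν σ F G = dirichletForm ν σ G F := by
  rw [dirichletForm, deathInner_comm, dirichletForm]

theorem dirichletForm_smul (c : ℝ) (F G : Cone X → ℝ) :
    dirichletForm ν σ (c • F) G = c * dirichletForm ν σ F G := by
  rw [dirichletForm, deathInner_smul, dirichletForm, ← integral_const_mul]
  rfl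

variable [NullSingletonClass σ]

theorem dirichletForm_eq_birthDirichletForm (hν : ∫⁻ s : PosReal, ENNReal.ofReal s ∂ν < ∞)
    (hF : F ∈ cylinderFunctions X) (hG : G ∈ cylinderFunctions X) :
    Integrable (deathInner F G) (poissonCone ν σ) ∧
      Integrable (birthInner ν σ F G) (poissonCone ν σ) ∧
      dirichletForm ν σ F G = birthDirichletForm ν σ F G := by
  obtain ⟨N, φ, g, g', hF, hG⟩ := exists_common_representation hF hG
  obtain ⟨h1, h2, h3⟩ := integral_mecke (ν.prod σ) φ (measurable_incrementProduct φ g g')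
    (integrable_incrementProduct ν σ hν φ g g')
  have hmp := measurePreserving_markedPoints ν σ hν
  have hd : deathInner F G = (fun γ : Config (Marked X) => ∫ p, incrementProduct φ g g'
      (γ.integrals φ - fun i => φ i p, p) ∂γ.toMeasure) ∘ markedPoints :=
    funext fun η => deathInner_eq hF hG η
  have hb : birthInner ν σ F G = (fun γ : Config (Marked X) => ∫ p, incrementProduct φ g g'
      (γ.integrals φ, p) ∂(ν.prod σ)) ∘ markedPoints :=
    funext fun η => birthInner_eq ν σ hF hG η
  have hi : ∀ f : Config (Marked X) → ℝ, Integrable f (poissonConfig (ν.prod σ)) →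
      ∫ η, (f ∘ markedPoints) η ∂(poissonCone ν σ) = ∫ γ, f γ ∂(poissonConfig (ν.prod σ)) := by
    intro f hf
    rw [← hmp.map_eq] at hf ⊢
    exact (integral_map hmp.aemeasurable hf.aestronglyMeasurable).symm
  refine ⟨?_, ?_, ?_⟩
  · rw [hd]
    exact hmp.integrable_comp_of_integrable h1
  · rw [hb]
    exact hmp.integrable_comp_of_integrable h2
  · rw [dirichletForm, birthDirichletForm, hd, hb, hi _ h1, hi _ h2, h3]

theorem dirichletForm_add (hν : ∫⁻ s : PosReal, ENNReal.ofReal s ∂ν < ∞)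
    (hF : F ∈ cylinderFunctions X) (hG : G ∈ cylinderFunctions X)
    (hH : H ∈ cylinderFunctions X) :
    dirichletForm ν σ (F + G) H = dirichletForm ν σ F H + dirichletForm ν σ G H := by
  rw [dirichletForm, deathInner_add hF hG hH]
  exact integral_add (dirichletForm_eq_birthDirichletForm ν σ hν hF hH).1
    (dirichletForm_eq_birthDirichletForm ν σ hν hG hH).1

theorem memLp_cylinderFunction (hν : ∫⁻ s : PosReal, ENNReal.ofReal s ∂ν < ∞)
    (hF : F ∈ cylinderFunctions X) : MemLp F 2 (poissonCone ν σ) := by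
  have := isProbabilityMeasure_poissonCone ν σ hν
  obtain ⟨N, -, g, φ, hF⟩ := mem_cylinderFunctions_iff.1 hF
  have hF' : F = fun η => g ((markedPoints η).integrals φ) := funext hF
  rw [hF']
  exact MemLp.of_bound (g.continuous.measurable.comp ((Config.measurable_integrals φ).comp
    measurable_markedPoints)).aestronglyMeasurable ‖g‖
    (Filter.Eventually.of_forall fun η => g.norm_coe_le_norm _)

/-- The birth side is used because adding a point drawn from the intensity sends almost every
configuration outside a given null event, so the birth gradient of `F` vanishes almost everywhere.
-/
theorem dirichletForm_eq_zero_of_ae_eq_zero (hν : ∫⁻ s : PosReal, ENNReal.ofReal s ∂ν < ∞)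
    (hF : F ∈ cylinderFunctions X) (hG : G ∈ cylinderFunctions X)
    (h0 : F =ᵐ[poissonCone ν σ] 0) : dirichletForm ν σ F G = 0 := by
  rw [(dirichletForm_eq_birthDirichletForm ν σ hν hF hG).2.2, birthDirichletForm]
  obtain ⟨N, φ, g, g', hF, hG⟩ := exists_common_representation hF hG
  have hmp := measurePreserving_markedPoints ν σ hν
  have hI := Config.measurable_integrals φ
  have hφ := CompactlySupportedContinuousMap.measurable_vector φ
  have hz : MeasurableSet {v | g v = 0} := g.continuous.measurable (measurableSet_singleton 0)
  have hS : MeasurableSet {q : (Fin N → ℝ) × Marked X | g (q.1 + fun i => φ i q.2) = 0} :=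
    (measurable_fst.add (hφ.comp measurable_snd)) hz
  have h1 : ∀ᵐ γ ∂(poissonConfig (ν.prod σ)), g (γ.integrals φ) = 0 := by
    rw [← hmp.map_eq]
    refine (ae_map_iff hmp.aemeasurable (hI hz)).2 ?_
    filter_upwards [h0] with η hη
    rw [← hF]
    exact hη
  have h2 : ∀ᵐ γ ∂(poissonConfig (ν.prod σ)), ∀ᵐ p ∂(ν.prod σ),
      g (γ.integrals φ + fun i => φ i p) = 0 := by
    have hm : Measurable ({q : (Fin N → ℝ) × Marked X | g (q.1 + fun i => φ i q.2) = 0}ᶜ.indicator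
        (1 : (Fin N → ℝ) × Marked X → ℝ≥0∞)) := measurable_one.indicator hS.compl
    -- On the left the shift by `φ(p)` cancels, so the indicator only tests `g (γ.integrals φ) ≠ 0`,
    -- which is almost surely false; the right side must then vanish too.
    have h3 := lintegral_mecke (ν.prod σ) φ hm
    have h4 : ∀ᵐ γ ∂(poissonConfig (ν.prod σ)), ∫⁻ p,
        {q : (Fin N → ℝ) × Marked X | g (q.1 + fun i => φ i q.2) = 0}ᶜ.indicator
        (1 : (Fin N → ℝ) × Marked X → ℝ≥0∞) (γ.integrals φ - fun i => φ i p, p) ∂γ.toMeasure =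
          0 := by
      filter_upwards [h1] with γ hγ
      have : ∀ p, {q : (Fin N → ℝ) × Marked X | g (q.1 + fun i => φ i q.2) = 0}ᶜ.indicator
          (1 : (Fin N → ℝ) × Marked X → ℝ≥0∞) (γ.integrals φ - fun i => φ i p, p) = 0 := by
        intro p
        refine indicator_of_notMem ?_ _
        simp [hγ]
      simp [this]
    have hmc : Measurable fun q : Config (Marked X) × Marked X =>
        {q : (Fin N → ℝ) × Marked X | g (q.1 + fun i => φ i q.2) = 0}ᶜ.indicator
        (1 : (Fin N → ℝ) × Marked X → ℝ≥0∞) (q.1.integrals φ, q.2) :=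
      hm.comp ((hI.comp measurable_fst).prodMk measurable_snd)
    rw [lintegral_congr_ae h4, lintegral_zero, eq_comm,
      lintegral_eq_zero_iff hmc.lintegral_prod_right'] at h3
    filter_upwards [h3] with γ hγ
    have hmγ : Measurable fun p : Marked X =>
        {q : (Fin N → ℝ) × Marked X | g (q.1 + fun i => φ i q.2) = 0}ᶜ.indicator
        (1 : (Fin N → ℝ) × Marked X → ℝ≥0∞) (γ.integrals φ, p) :=
      hm.comp (measurable_const.prodMk measurable_id)
    filter_upwards [(lintegral_eq_zero_iff hmγ).1 hγ] with p hp
    by_contra hne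
    rw [Pi.zero_apply, indicator_of_mem (by exact hne)] at hp
    exact one_ne_zero hp
  have h5 : ∀ᵐ η ∂(poissonCone ν σ), g ((markedPoints η).integrals φ) = 0 :=
    hmp.quasiMeasurePreserving.ae h1
  have h6 : ∀ᵐ η ∂(poissonCone ν σ), ∀ᵐ p ∂(ν.prod σ),
      g ((markedPoints η).integrals φ + fun i => φ i p) = 0 :=
    hmp.quasiMeasurePreserving.ae h2
  refine integral_eq_zero_of_ae ?_
  filter_upwards [h5, h6] with η h7 h8
  rw [birthInner_eq ν σ hF hG]
  refine integral_eq_zero_of_ae ?_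
  filter_upwards [h8] with p hp
  simp [incrementProduct, h7, hp]

theorem dirichletForm_congr_left (hν : ∫⁻ s : PosReal, ENNReal.ofReal s ∂ν < ∞)
    (hF : F ∈ cylinderFunctions X) (hG : G ∈ cylinderFunctions X)
    (hH : H ∈ cylinderFunctions X) (h : F =ᵐ[poissonCone ν σ] G) :
    dirichletForm ν σ F H = dirichletForm ν σ G H := by
  have h0 : F - G =ᵐ[poissonCone ν σ] 0 := by
    filter_upwards [h] with η hη
    rw [Pi.sub_apply, hη, sub_self, Pi.zero_apply]
  have h1 := dirichletForm_add ν σ hν (Submodule.sub_mem _ hF hG) hG hH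
  rwa [sub_add_cancel, dirichletForm_eq_zero_of_ae_eq_zero ν σ hν (Submodule.sub_mem _ hF hG) hH
    h0, zero_add] at h1

theorem dirichletForm_congr (hν : ∫⁻ s : PosReal, ENNReal.ofReal s ∂ν < ∞) {F' G' : Cone X → ℝ}
    (hF : F ∈ cylinderFunctions X) (hF' : F' ∈ cylinderFunctions X)
    (hG : G ∈ cylinderFunctions X) (hG' : G' ∈ cylinderFunctions X)
    (h : F =ᵐ[poissonCone ν σ] F') (h' : G =ᵐ[poissonCone ν σ] G') :
    dirichletForm ν σ F G = dirichletForm ν σ F' G' := by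
  rw [dirichletForm_congr_left ν σ hν hF hF' hG h, dirichletForm_comm,
    dirichletForm_congr_left ν σ hν hG hG' hF' h', dirichletForm_comm]

/-- The subspace of `L²` formed by the classes of cylinder functions. -/
def cylinderClasses : Submodule ℝ (Lp ℝ 2 (poissonCone ν σ)) where
  carrier := {u | ∃ F ∈ cylinderFunctions X, u =ᵐ[poissonCone ν σ] F}
  zero_mem' := ⟨0, Submodule.zero_mem _, Lp.coeFn_zero _ _ _⟩
  add_mem' := by
    rintro u v ⟨F, hF, hu⟩ ⟨G, hG, hv⟩
    exact ⟨F + G, Submodule.add_mem _ hF hG, (Lp.coeFn_add u v).trans (hu.add hv)⟩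
  smul_mem' := by
    rintro c u ⟨F, hF, hu⟩
    exact ⟨c • F, Submodule.smul_mem _ c hF, (Lp.coeFn_smul c u).trans (hu.const_smul c)⟩

theorem existsUnique_bilinForm (hν : ∫⁻ s : PosReal, ENNReal.ofReal s ∂ν < ∞) :
    ∃! B : LinearMap.BilinForm ℝ (cylinderClasses ν σ),
      (∀ u v : cylinderClasses ν σ, B u v = B v u) ∧
      ∀ F ∈ cylinderFunctions X, ∀ G ∈ cylinderFunctions X, ∀ u v : cylinderClasses ν σ,
        (u : Lp ℝ 2 (poissonCone ν σ)) =ᵐ[poissonCone ν σ] F →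
        (v : Lp ℝ 2 (poissonCone ν σ)) =ᵐ[poissonCone ν σ] G →
        B u v = dirichletForm ν σ F G := by
  -- The representatives are arbitrary; `dirichletForm_congr` removes the dependence on the choice
  -- and lets sums and multiples of representatives be used.
  choose R hR hRae using fun u : cylinderClasses ν σ => u.2
  have hadd : ∀ u v w, dirichletForm ν σ (R (u + v)) (R w) =
      dirichletForm ν σ (R u) (R w) + dirichletForm ν σ (R v) (R w) := by
    intro u v w
    rw [← dirichletForm_add ν σ hν (hR u) (hR v) (hR w)]
    refine dirichletForm_congr_left ν σ hν (hR _) (Submodule.add_mem _ (hR u) (hR v)) (hR w) ?_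
    exact (hRae (u + v)).symm.trans ((Lp.coeFn_add u.1 v.1).trans ((hRae u).add (hRae v)))
  have hsmul : ∀ (c : ℝ) u w, dirichletForm ν σ (R (c • u)) (R w) =
      c * dirichletForm ν σ (R u) (R w) := by
    intro c u w
    rw [← dirichletForm_smul]
    refine dirichletForm_congr_left ν σ hν (hR _) (Submodule.smul_mem _ c (hR u)) (hR w) ?_
    exact (hRae (c • u)).symm.trans ((Lp.coeFn_smul c u.1).trans ((hRae u).const_smul c))
  refine ⟨LinearMap.mk₂ ℝ (fun u v => dirichletForm ν σ (R u) (R v)) hadd hsmul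
    (fun u v w => ?_) (fun c u w => ?_), ⟨fun u v => dirichletForm_comm ν σ _ _, ?_⟩, ?_⟩
  · rw [dirichletForm_comm, hadd, dirichletForm_comm ν σ (R v), dirichletForm_comm ν σ (R w)]
  · rw [dirichletForm_comm, hsmul, dirichletForm_comm ν σ (R w), smul_eq_mul]
  · intro F hF G hG u v hu hv
    exact dirichletForm_congr ν σ hν (hR u) hF (hR v) hG ((hRae u).symm.trans hu)
      ((hRae v).symm.trans hv)
  · rintro B ⟨-, hB⟩
    refine LinearMap.ext₂ fun u v => ?_
    exact hB (R u) (hR u) (R v) (hR v) u v (hRae u) (hRae v)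

end DirichletForm

/-! ### The proposition -/

theorem mainTheorem4 {X : Type*} [TopologicalSpace X] [PolishSpace X] [LocallyCompactSpace X]
    [MeasurableSpace X] [BorelSpace X]
    (ν : Measure PosReal) [IsFiniteMeasureOnCompacts ν] [NullSingletonClass ν]
    (σ : Measure X) [IsFiniteMeasureOnCompacts σ] [NullSingletonClass σ]
    (hν : ∫⁻ s : PosReal, ENNReal.ofReal s ∂ν < ∞) :
    -- `π_{𝕂, ν ⊗ σ}` is a probability measure and the cylinder functions lie in `L²`
    IsProbabilityMeasure (poissonCone ν σ) ∧
    (∀ F ∈ cylinderFunctions X, MemLp F 2 (poissonCone ν σ)) ∧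
    -- the gradients lie in the tangent spaces
    (∀ F ∈ cylinderFunctions X, ∀ η : Cone X,
      MemLp (deathGradient F η) 2 η.toMeasure ∧
      MemLp (birthGradient F η) 2 (birthMeasure ν σ)) ∧
    -- the Dirichlet integrals of the two gradients exist and coincide
    (∀ F ∈ cylinderFunctions X, ∀ G ∈ cylinderFunctions X,
      Integrable (deathInner F G) (poissonCone ν σ) ∧
      Integrable (birthInner ν σ F G) (poissonCone ν σ) ∧
      dirichletForm ν σ F G = birthDirichletForm ν σ F G) ∧
    -- they only depend on the classes of `F` and `G` in `L²`, and define a symmetric bilinear form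
    -- on the linear subspace of `L²` formed by the classes of cylinder functions
    ∃ D : Submodule ℝ (Lp ℝ 2 (poissonCone ν σ)),
      (∀ u : Lp ℝ 2 (poissonCone ν σ),
        u ∈ D ↔ ∃ F ∈ cylinderFunctions X, u =ᵐ[poissonCone ν σ] F) ∧
      ∃! B : LinearMap.BilinForm ℝ D,
        (∀ u v : D, B u v = B v u) ∧
        ∀ F ∈ cylinderFunctions X, ∀ G ∈ cylinderFunctions X, ∀ u v : D,
          (u : Lp ℝ 2 (poissonCone ν σ)) =ᵐ[poissonCone ν σ] F →
          (v : Lp ℝ 2 (poissonCone ν σ)) =ᵐ[poissonCone ν σ] G →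
          B u v = dirichletForm ν σ F G := by
  exact ⟨isProbabilityMeasure_poissonCone ν σ hν, fun F hF => memLp_cylinderFunction ν σ hν hF,
    fun F hF η => ⟨memLp_deathGradient hF η, memLp_birthGradient ν σ hν hF η⟩,
    fun F hF G hG => dirichletForm_eq_birthDirichletForm ν σ hν hF hG,
    cylinderClasses ν σ, fun u => Iff.rfl, existsUnique_bilinForm ν σ hν⟩
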